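/- Let $K=K^1\cup K^2\cup K^3\subset\mathbb R^2$ be the Koch snowflake built on an equilateral triangle of side $1$ (each $K^i$ is the Koch curve erected outwards on one side), let $\Omega$ be the bounded open domain enclosed by $K=\partial\Omega$, let $d_f=\ln 4/\ln 3$, and let $\mu=\mu_1+\mu_2+\mu_3$, where $\mu_i$ is the $d_f$-dimensional Hausdorff measure restricted to $K^i$ and normalized to total mass $1$. Let $s,p\in\mathbb R$ satisfy $2<sp<p$ (so $p>2$ and $0<s<1$), and let $W^{s,p}(\Omega)$ be the space of all $u\in L^p(\Omega)$ (modulo equality almost everywhere) such that $$\iint_{\Omega\times\Omega}\frac{|u(x)-u(y)|^p}{|x-y|^{2+sp}}\,dx\,dy<\infty .$$ For $u\in W^{s,p}(\Omega)$ the values of $u$ on $\partial\Omega$ are understood in the sense of the trace $$u(x)=\lim_{r\to0^+}\frac1{|B(x,r)\cap\Omega|}\int_{B(x,r)\cap\Omega}u(y)\,dy .$$ Let $f\in L^1(\Omega)$, let $b\in C(\overline\Omega)$ with $b(x)>0$ for all $x\in\overline\Omega$, and let $\varphi_1,\varphi_2\in W^{s,p}(\Omega)$ with $\varphi_1\le\varphi_2$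 in $\Omega$. Put $$\mathcal K=\{v\in W^{s,p}(\Omega):\varphi_1\le v\le\varphi_2\text{ in }\Omega\},$$ $$J_p(v)=\frac1p\iint_{\Omega\times\Omega}\frac{|v(x)-v(y)|^p}{|x-y|^{2+sp}}\,dx\,dy-\int_\Omega f(x)v(x)\,dx+\frac1p\int_{\partial\Omega}b(x)|v(x)|^p\,d\mu(x),$$ where the inequalities hold almost everywhere, and assume that $\mathcal K\neq\emptyset$. Then there is exactly one $u\in\mathcal K$ such that $J_p(u)=\min_{v\in\mathcal K}J_p(v)$. -/

import Mathlib

open MeasureTheory Filter Topology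
open scoped ComplexConjugate

noncomputable section

/- The plane `ℝ²` is identified with `ℂ`: the norm of `ℂ` is the Euclidean norm and its `volume`
is the two-dimensional Lebesgue measure. -/

namespace Snowflake

/-- The point `ω = exp (i π / 3) = 1 / 2 + (√3 / 2) i`. -/
def omega : ℂ := ⟨1 / 2, √3 / 2⟩

/-- The four similarities of ratio `1 / 3` generating the Koch curve over the segment `[0, 1]`
(with the bump pointing upwards). They carry the segment `[0, 1]` onto the four segments of the
polygonal curve with vertices `0`, `1 / 3`, `1 / 2 + (√3 / 6) i`, `2 / 3`, `1`. -/
def kochMap : Fin 4 → ℂ → ℂ :=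
  ![fun z => z / 3,
    fun z => (1 + omega * z) / 3,
    fun z => (1 + omega + conj omega * z) / 3,
    fun z => (2 + z) / 3]

/-- The `n`-th stage of the construction of the Koch curve by covering triangles: it starts from
the closed triangle with vertices `0`, `1` and `(1 + ω) / 3 = 1 / 2 + (√3 / 6) i`, and each triangle
is then replaced by its images under the four generating similarities. -/
def kochStage : ℕ → Set ℂ
  | 0 => convexHull ℝ {0, 1, (1 + omega) / 3}
  | n + 1 => ⋃ i : Fin 4, kochMap i '' kochStage n

/-- The Koch curve over the segment `[0, 1]`, that is, the attractor of the four similarities,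
obtained as the intersection of the (decreasing) stages. -/
def kochCurve : Set ℂ := ⋂ n : ℕ, kochStage n

/-- The isometries carrying the segment `[0, 1]` onto the three sides `[0, 1]`, `[1, conj ω]`,
`[conj ω, 0]` of the equilateral triangle with vertices `0`, `1`, `conj ω = 1 / 2 - (√3 / 2) i`; the
upper side of `[0, 1]` is carried to the outer side. -/
def sideMap : Fin 3 → ℂ → ℂ :=
  ![fun z => z,
    fun z => 1 - omega * z,
    fun z => conj omega * (1 - z)]

/-- The three Koch curves `K¹`, `K²`, `K³`. -/
def side (i : Fin 3) : Set ℂ := sideMap i '' kochCurve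

/-- The Koch snowflake `K`. -/
def curve : Set ℂ := ⋃ i : Fin 3, side i

/-- The bounded domain `Ω` enclosed by the closed Jordan curve `K`: the points off `K` whose
connected component in the complement of `K` is bounded. -/
def domain : Set ℂ :=
  {z | z ∈ curveᶜ ∧ Bornology.IsBounded (connectedComponentIn curveᶜ z)}

/-- The Hausdorff dimension `ln 4 / ln 3` of the Koch snowflake. -/
def dimension : ℝ := Real.log 4 / Real.log 3

/-- The measure `μ = μ₁ + μ₂ + μ₃` supported on `K = ∂Ω`, with `μᵢ` the Hausdorff measure of
dimension `ln 4 / ln 3` restricted to `Kⁱ` and normalized to total mass one. -/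
def boundaryMeasure : Measure ℂ :=
  ∑ i : Fin 3, (Measure.hausdorffMeasure dimension (side i))⁻¹ •
    (Measure.hausdorffMeasure dimension).restrict (side i)

end Snowflake

namespace FracSobolev

/-- The Lebesgue space `L^p(G)` of a planar set `G` (real exponent, classes modulo equality
almost everywhere). -/
abbrev LebesgueSpace (p : ℝ) (G : Set ℂ) : Type :=
  Lp ℝ (ENNReal.ofReal p) ((volume : Measure ℂ).restrict G)

/-- The Gagliardo energy `∬_{G×G} |u(x) - u(y)|^p / |x - y|^(2 + s p) dx dy`, with values
in `[0, ∞]`. -/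
def gagliardo (s p : ℝ) (G : Set ℂ) (u : ℂ → ℝ) : ENNReal :=
  ∫⁻ z : ℂ × ℂ, ENNReal.ofReal (|u z.1 - u z.2| ^ p / ‖z.1 - z.2‖ ^ (2 + s * p))
    ∂(((volume : Measure ℂ).restrict G).prod ((volume : Measure ℂ).restrict G))

/-- The fractional Sobolev space `W^{s,p}(G)`, as a set of elements of `L^p(G)`. -/
def space (s p : ℝ) (G : Set ℂ) : Set (LebesgueSpace p G) :=
  {u | gagliardo s p G u < ⊤}

/-- The trace `γ₀ u (x) = lim_{r → 0+} |B(x,r) ∩ G|⁻¹ ∫_{B(x,r) ∩ G} u dy`. -/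
def trace (G : Set ℂ) (u : ℂ → ℝ) (x : ℂ) : ℝ :=
  limUnder (𝓝[>] (0 : ℝ)) fun r : ℝ => ⨍ y in Metric.ball x r ∩ G, u y

end FracSobolev

namespace Snowflake

open FracSobolev

/-- The functional `J_p` on the snowflake domain. -/
def energy (s p : ℝ) (f b : ℂ → ℝ) (v : LebesgueSpace p domain) : ℝ :=
  1 / p * (gagliardo s p domain v).toReal
    - (∫ x in domain, f x * v x)
    + 1 / p * (∫ x, b x * |trace domain v x| ^ p ∂boundaryMeasure)

/-- The convex set `𝒦` of the functions of `W^{s,p}(Ω)` between the two obstacles. -/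
def admissible (s p : ℝ) (φ₁ φ₂ : LebesgueSpace p domain) : Set (LebesgueSpace p domain) :=
  {v | v ∈ space s p domain ∧
    ∀ᵐ x ∂((volume : Measure ℂ).restrict domain), φ₁ x ≤ v x ∧ v x ≤ φ₂ x}

end Snowflake

end

noncomputable section

namespace Snowflake

/-! Since `s * p > 2`, Morrey's inequality makes every function of the space essentially bounded and
gives it a trace at every point of the snowflake. The functional is `1 / p` times a `p`-homogeneous
penalty `Q` (seminorm plus boundary term), minus a linear term. Three properties of `Q` carry the
proof. Clarkson's inequality, valid for `p ≥ 2`, gives `Q((v+w)/2) + Q((v-w)/2) ≤ (Q(v) + Q(w))/2`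
(`penalty_clarkson`). The essential supremum of `|u|` is at most `C * Q(u)^(1/p)`, because `b` is
bounded below and the boundary has positive mass (`exists_ae_abs_le_penalty`). Finally, `Q` is lower
semicontinuous under uniform convergence (`penalty_le_liminf`).

If `v` and `w` have energy within `δ` of the infimum, their midpoint is admissible, so `Q((v-w)/2) ≤
p * δ` and `v`, `w` are uniformly close (`exists_ae_abs_sub_le`). A minimizing sequence is therefore
uniformly Cauchy and its limit is a minimizer, with no weak compactness involved; `δ = 0` gives
uniqueness. The obstacles bound all admissible functions uniformly, which is what lets `f` be merely
integrable.

Two geometric facts about the snowflake are needed. Morrey's inequality rests on the measure density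
condition `|B(x,r) ∩ Ω| ≥ c r²` up to the boundary (`exists_measure_density`). The union of the
inscribed polygons has its frontier in the curve, hence lies in `Ω` apart from the curve
(`polygonUnion_diff_subset`), without any appeal to the Jordan curve theorem; each boundary point
sees a ball of comparable size inside it at every scale. The boundary measure must moreover be
finite and nonzero, that is, the Koch curve has positive finite Hausdorff measure: covering by cells
bounds it above, and the mass distribution principle bounds it below. -/

/-! ### Similarities of the construction in rational coordinates -/

lemma sqrt_three_mul_self : √3 * √3 = (3 : ℝ) := Real.mul_self_sqrt (by norm_num)

lemma norm_omega : ‖omega‖ = 1 := by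
  rw [Complex.norm_def, Real.sqrt_eq_one, Complex.normSq_apply]
  simp only [omega]
  linarith [sqrt_three_mul_self]

/-- The rescaled height `√3 · Im z`; in the coordinates `(z.re, height z)` all similarities of the
construction are given by rational matrices. -/
def height (z : ℂ) : ℝ := √3 * z.im

lemma continuous_height : Continuous height := continuous_const.mul Complex.continuous_im

lemma height_eq_zero {z : ℂ} : height z = 0 ↔ z.im = 0 := by
  simp [height]

/-- The linear parts of the maps `kochMap i`. -/
def kochRatio : Fin 4 → ℂ := ![1 / 3, omega / 3, conj omega / 3, 1 / 3]

/-- The linear parts of the maps `sideMap i`. -/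
def sideRatio : Fin 3 → ℂ := ![1, -omega, -conj omega]

lemma norm_kochRatio (i : Fin 4) : ‖kochRatio i‖ = 1 / 3 := by
  fin_cases i <;> simp [kochRatio, norm_omega]

lemma norm_sideRatio (i : Fin 3) : ‖sideRatio i‖ = 1 := by
  fin_cases i <;> simp [sideRatio, norm_omega]

lemma kochMap_eq (i : Fin 4) (z : ℂ) : kochMap i z = kochMap i 0 + kochRatio i * z := by
  fin_cases i <;> simp [kochMap, kochRatio] <;> ring

lemma sideMap_eq (i : Fin 3) (z : ℂ) : sideMap i z = sideMap i 0 + sideRatio i * z := by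
  fin_cases i <;> simp [sideMap, sideRatio] <;> ring

lemma norm_kochMap_sub (i : Fin 4) (z w : ℂ) :
    ‖kochMap i z - kochMap i w‖ = ‖z - w‖ / 3 := by
  rw [kochMap_eq i z, kochMap_eq i w, add_sub_add_left_eq_sub, ← mul_sub, norm_mul,
    norm_kochRatio]
  ring

lemma norm_sideMap_sub (i : Fin 3) (z w : ℂ) :
    ‖sideMap i z - sideMap i w‖ = ‖z - w‖ := by
  rw [sideMap_eq i z, sideMap_eq i w, add_sub_add_left_eq_sub, ← mul_sub, norm_mul,
    norm_sideRatio, one_mul]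

/-- The map `kochMap i` as a homeomorphism. -/
def kochHomeo (i : Fin 4) : ℂ ≃ₜ ℂ :=
  (Homeomorph.mulLeft₀ (kochRatio i) (norm_ne_zero_iff.1 (by rw [norm_kochRatio]; norm_num))).trans
    (Homeomorph.addLeft (kochMap i 0))

/-- The map `sideMap i` as a homeomorphism. -/
def sideHomeo (i : Fin 3) : ℂ ≃ₜ ℂ :=
  (Homeomorph.mulLeft₀ (sideRatio i) (norm_ne_zero_iff.1 (by rw [norm_sideRatio]; norm_num))).trans
    (Homeomorph.addLeft (sideMap i 0))

lemma coe_kochHomeo (i : Fin 4) : ⇑(kochHomeo i) = kochMap i :=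
  funext fun z => (kochMap_eq i z).symm

lemma coe_sideHomeo (i : Fin 3) : ⇑(sideHomeo i) = sideMap i :=
  funext fun z => (sideMap_eq i z).symm

lemma continuous_kochMap (i : Fin 4) : Continuous (kochMap i) :=
  coe_kochHomeo i ▸ (kochHomeo i).continuous

lemma continuous_sideMap (i : Fin 3) : Continuous (sideMap i) :=
  coe_sideHomeo i ▸ (sideHomeo i).continuous

lemma isometry_sideMap (i : Fin 3) : Isometry (sideMap i) :=
  Isometry.of_dist_eq fun z w => by simp only [dist_eq_norm, norm_sideMap_sub]

lemma kochMap_injective (i : Fin 4) : Function.Injective (kochMap i) :=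
  coe_kochHomeo i ▸ (kochHomeo i).injective

lemma image_kochMap_interior (i : Fin 4) (s : Set ℂ) :
    kochMap i '' interior s = interior (kochMap i '' s) :=
  coe_kochHomeo i ▸ (kochHomeo i).image_interior s

lemma image_sideMap_interior (i : Fin 3) (s : Set ℂ) :
    sideMap i '' interior s = interior (sideMap i '' s) :=
  coe_sideHomeo i ▸ (sideHomeo i).image_interior s

lemma kochMap_image_ball (i : Fin 4) (y : ℂ) (r : ℝ) :
    kochMap i '' Metric.ball y r = Metric.ball (kochMap i y) (r / 3) := by
  ext z
  obtain ⟨w, rfl⟩ : ∃ w, kochMap i w = z := coe_kochHomeo i ▸ (kochHomeo i).surjective z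
  rw [(kochMap_injective i).mem_set_image]
  simp only [Metric.mem_ball, dist_eq_norm, norm_kochMap_sub]
  constructor <;> intro h <;> linarith

lemma sideMap_image_ball (i : Fin 3) (y : ℂ) (r : ℝ) :
    sideMap i '' Metric.ball y r = Metric.ball (sideMap i y) r := by
  ext z
  obtain ⟨w, rfl⟩ : ∃ w, sideMap i w = z := coe_sideHomeo i ▸ (sideHomeo i).surjective z
  rw [(isometry_sideMap i).injective.mem_set_image]
  simp only [Metric.mem_ball, dist_eq_norm, norm_sideMap_sub]

lemma kochMap_zero_coord (z : ℂ) :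
    (kochMap 0 z).re = z.re / 3 ∧ height (kochMap 0 z) = height z / 3 := by
  have h : kochMap 0 z = ((1 / 3 : ℝ) : ℂ) * z := by simp [kochMap]; ring
  rw [h]
  simp only [height, Complex.re_ofReal_mul, Complex.im_ofReal_mul]
  constructor <;> ring

lemma kochMap_one_coord (z : ℂ) :
    (kochMap 1 z).re = (2 + z.re - height z) / 6 ∧
      height (kochMap 1 z) = (3 * z.re + height z) / 6 := by
  have h : kochMap 1 z = ((1 / 3 : ℝ) : ℂ) * (1 + omega * z) := by simp [kochMap]; ring
  rw [h]
  simp only [height, Complex.ofReal_re, Complex.ofReal_im, Complex.add_re, Complex.add_im,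
    Complex.mul_re, Complex.mul_im, Complex.one_re, Complex.one_im, omega]
  constructor
  · ring
  · linear_combination (z.re / 6) * sqrt_three_mul_self

lemma kochMap_two_coord (z : ℂ) :
    (kochMap 2 z).re = (3 + z.re + height z) / 6 ∧
      height (kochMap 2 z) = (3 - 3 * z.re + height z) / 6 := by
  have h : kochMap 2 z = ((1 / 3 : ℝ) : ℂ) * (1 + omega + conj omega * z) := by
    simp [kochMap]; ring
  rw [h]
  simp only [height, Complex.ofReal_re, Complex.ofReal_im, Complex.add_re, Complex.add_im,
    Complex.mul_re, Complex.mul_im, Complex.one_re, Complex.one_im, Complex.conj_re,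
    Complex.conj_im, omega]
  constructor
  · ring
  · linear_combination ((1 - z.re) / 6) * sqrt_three_mul_self

lemma kochMap_three_coord (z : ℂ) :
    (kochMap 3 z).re = (2 + z.re) / 3 ∧ height (kochMap 3 z) = height z / 3 := by
  have h : kochMap 3 z = ((1 / 3 : ℝ) : ℂ) * (2 + z) := by simp [kochMap]; ring
  rw [h]
  simp only [height, Complex.re_ofReal_mul, Complex.im_ofReal_mul, Complex.add_re, Complex.add_im,
    Complex.re_ofNat, Complex.im_ofNat]
  constructor <;> ring

lemma sideMap_zero_coord (z : ℂ) :
    (sideMap 0 z).re = z.re ∧ height (sideMap 0 z) = height z := ⟨rfl, rfl⟩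

lemma sideMap_one_coord (z : ℂ) :
    (sideMap 1 z).re = (2 - z.re + height z) / 2 ∧
      height (sideMap 1 z) = -(3 * z.re + height z) / 2 := by
  have h : sideMap 1 z = 1 - omega * z := rfl
  rw [h]
  simp only [height, Complex.sub_re, Complex.sub_im,
    Complex.mul_re, Complex.mul_im, Complex.one_re, Complex.one_im, omega]
  constructor
  · ring
  · linear_combination (-z.re / 2) * sqrt_three_mul_self

lemma sideMap_two_coord (z : ℂ) :
    (sideMap 2 z).re = (1 - z.re - height z) / 2 ∧
      height (sideMap 2 z) = (3 * z.re - height z - 3) / 2 := by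
  have h : sideMap 2 z = conj omega * (1 - z) := rfl
  rw [h]
  simp only [height, Complex.sub_re, Complex.sub_im, Complex.conj_re, Complex.conj_im,
    Complex.mul_re, Complex.mul_im, Complex.one_re, Complex.one_im, omega]
  constructor
  · ring
  · linear_combination ((z.re - 1) / 2) * sqrt_three_mul_self

/-! ### Covering triangles -/

lemma mem_kochStage_zero {z : ℂ} :
    z ∈ kochStage 0 ↔ 0 ≤ height z ∧ height z ≤ z.re ∧ height z ≤ 1 - z.re := by
  have h3 : 0 < √(3 : ℝ) := by positivity
  constructor
  · have hconv : Convex ℝ {z : ℂ | 0 ≤ height z ∧ height z ≤ z.re ∧ height z ≤ 1 - z.re} := by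
      intro x hx y hy a b ha hb hab
      simp only [height, Set.mem_ofPred_eq, Complex.add_re, Complex.add_im, Complex.smul_re,
        Complex.smul_im, smul_eq_mul] at hx hy ⊢
      obtain ⟨h1, h2, h3⟩ := hx
      obtain ⟨k1, k2, k3⟩ := hy
      have e1 := mul_le_mul_of_nonneg_left h1 ha
      have e2 := mul_le_mul_of_nonneg_left h2 ha
      have e3 := mul_le_mul_of_nonneg_left h3 ha
      have g1 := mul_le_mul_of_nonneg_left k1 hb
      have g2 := mul_le_mul_of_nonneg_left k2 hb
      have g3 := mul_le_mul_of_nonneg_left k3 hb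
      refine ⟨by linarith, by linarith, by linarith⟩
    intro hz
    refine convexHull_min ?_ hconv hz
    rintro w (rfl | rfl | rfl)
    · simp [height]
    · simp [height]
    · have h : (1 + omega) / 3 = ((1 / 3 : ℝ) : ℂ) * (1 + omega) := by simp; ring
      rw [h]
      simp only [height, Set.mem_ofPred_eq, Complex.re_ofReal_mul, Complex.im_ofReal_mul,
        Complex.add_re, Complex.add_im, Complex.one_re, Complex.one_im, omega]
      have := sqrt_three_mul_self
      refine ⟨by positivity, by linarith, by linarith⟩
  · rintro ⟨h1, h2, h3⟩
    have hmem : ∀ w ∈ ({0, 1, (1 + omega) / 3} : Set ℂ),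
        w ∈ convexHull ℝ ({0, 1, (1 + omega) / 3} : Set ℂ) := fun w hw =>
      subset_convexHull ℝ _ hw
    -- The weights are the barycentric coordinates; the apex has real part and height `1 / 2`.
    have key := (convex_convexHull ℝ ({0, 1, (1 + omega) / 3} : Set ℂ)).sum_mem
      (t := Finset.univ) (w := ![1 - z.re - height z, z.re - height z, 2 * height z])
      (z := ![0, 1, (1 + omega) / 3])
      (by intro i _; fin_cases i <;> simp <;> linarith)
      (by simp [Fin.sum_univ_three]; ring)
      (by intro i _; fin_cases i <;> exact hmem _ (by simp))
    have hz : z = ∑ i, (![1 - z.re - height z, z.re - height z, 2 * height z] : Fin 3 → ℝ) i •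
        (![0, 1, (1 + omega) / 3] : Fin 3 → ℂ) i := by
      have h : (1 + omega) / 3 = ((1 / 3 : ℝ) : ℂ) * (1 + omega) := by simp; ring
      rw [h]
      apply Complex.ext
      · simp [Fin.sum_univ_three, omega]; ring
      · simp [Fin.sum_univ_three, omega, height]
        linear_combination (-z.im / 3) * sqrt_three_mul_self
    rw [hz]
    exact key

lemma forall_fin_four {P : Fin 4 → Prop} (h0 : P 0) (h1 : P 1) (h2 : P 2) (h3 : P 3) :
    ∀ i, P i := by
  intro i; fin_cases i <;> assumption

lemma forall_fin_three {P : Fin 3 → Prop} (h0 : P 0) (h1 : P 1) (h2 : P 2) :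
    ∀ i, P i := by
  intro i; fin_cases i <;> assumption

lemma kochMap_mem_kochStage_zero (i : Fin 4) {z : ℂ} (hz : z ∈ kochStage 0) :
    kochMap i z ∈ kochStage 0 := by
  rw [mem_kochStage_zero] at hz
  obtain ⟨h1, h2, h3⟩ := hz
  revert i
  apply forall_fin_four
  · obtain ⟨e1, e2⟩ := kochMap_zero_coord z
    rw [mem_kochStage_zero, e1, e2]
    refine ⟨by linarith, by linarith, by linarith⟩
  · obtain ⟨e1, e2⟩ := kochMap_one_coord z
    rw [mem_kochStage_zero, e1, e2]
    refine ⟨by linarith, by linarith, by linarith⟩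
  · obtain ⟨e1, e2⟩ := kochMap_two_coord z
    rw [mem_kochStage_zero, e1, e2]
    refine ⟨by linarith, by linarith, by linarith⟩
  · obtain ⟨e1, e2⟩ := kochMap_three_coord z
    rw [mem_kochStage_zero, e1, e2]
    refine ⟨by linarith, by linarith, by linarith⟩

lemma mem_kochStage_succ {n : ℕ} {z : ℂ} :
    z ∈ kochStage (n + 1) ↔ ∃ i, ∃ w ∈ kochStage n, kochMap i w = z := by
  simp [kochStage]

lemma kochMap_mem_kochStage (i : Fin 4) {n : ℕ} {z : ℂ} (hz : z ∈ kochStage n) :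
    kochMap i z ∈ kochStage (n + 1) :=
  mem_kochStage_succ.2 ⟨i, z, hz, rfl⟩

lemma kochStage_succ_subset (n : ℕ) : kochStage (n + 1) ⊆ kochStage n := by
  induction n with
  | zero =>
    intro z hz
    obtain ⟨i, w, hw, rfl⟩ := mem_kochStage_succ.1 hz
    exact kochMap_mem_kochStage_zero i hw
  | succ n ih =>
    intro z hz
    obtain ⟨i, w, hw, rfl⟩ := mem_kochStage_succ.1 hz
    exact kochMap_mem_kochStage i (ih hw)

lemma kochStage_antitone : Antitone kochStage := antitone_nat_of_succ_le kochStage_succ_subset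

lemma isCompact_kochStage (n : ℕ) : IsCompact (kochStage n) := by
  induction n with
  | zero =>
    exact Set.Finite.isCompact_convexHull ℝ (Set.toFinite _)
  | succ n ih => exact isCompact_iUnion fun i => ih.image (continuous_kochMap i)

lemma isCompact_kochCurve : IsCompact kochCurve :=
  (isCompact_kochStage 0).of_isClosed_subset
    (isClosed_iInter fun n => (isCompact_kochStage n).isClosed) (Set.iInter_subset _ 0)

lemma isCompact_side (i : Fin 3) : IsCompact (side i) :=
  isCompact_kochCurve.image (continuous_sideMap i)

lemma isCompact_curve : IsCompact curve := isCompact_iUnion isCompact_side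

lemma kochMap_zero_zero : kochMap 0 0 = 0 := by simp [kochMap]

lemma kochMap_three_one : kochMap 3 1 = 1 := by simp [kochMap]; norm_num

lemma zero_mem_kochStage (n : ℕ) : (0 : ℂ) ∈ kochStage n := by
  induction n with
  | zero => exact subset_convexHull ℝ _ (by simp)
  | succ n ih => exact mem_kochStage_succ.2 ⟨0, 0, ih, kochMap_zero_zero⟩

lemma one_mem_kochStage (n : ℕ) : (1 : ℂ) ∈ kochStage n := by
  induction n with
  | zero => exact subset_convexHull ℝ _ (by simp)
  | succ n ih => exact mem_kochStage_succ.2 ⟨3, 1, ih, kochMap_three_one⟩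

lemma abs_im_le_abs_height (z : ℂ) : |z.im| ≤ |height z| := by
  rw [height, abs_mul, abs_of_pos (by positivity : 0 < √(3 : ℝ))]
  refine le_mul_of_one_le_left (abs_nonneg _) ?_
  rw [Real.one_le_sqrt]
  norm_num

lemma norm_sub_le_of_mem_kochStage_zero {z w : ℂ} (hz : z ∈ kochStage 0) (hw : w ∈ kochStage 0) :
    ‖z - w‖ ≤ 2 := by
  rw [mem_kochStage_zero] at hz hw
  have h1 := Complex.norm_le_abs_re_add_abs_im (z - w)
  have h2 := abs_im_le_abs_height (z - w)
  have h3 : height (z - w) = height z - height w := by simp [height]; ring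
  rw [h3] at h2
  have h4 : |height z - height w| ≤ 1 := by rw [abs_le]; constructor <;> linarith
  have h5 : |(z - w).re| ≤ 1 := by
    rw [abs_le, Complex.sub_re]; constructor <;> linarith
  linarith

/-! ### Inscribed polygons and the frontier of their union -/

/-- The equilateral triangle erected on the middle third of the segment `[0, 1]`. -/
def bump : Set ℂ := {z | 0 ≤ height z ∧ height z ≤ 3 * z.re - 1 ∧ height z ≤ 2 - 3 * z.re}

/-- The region between the segment `[0, 1]` and the `n`-th polygonal approximation of the Koch
curve. -/
def cap : ℕ → Set ℂ
  | 0 => ∅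
  | n + 1 => bump ∪ ⋃ i : Fin 4, kochMap i '' cap n

/-- The closed lower half plane. -/
def lowerPlane : Set ℂ := {z | height z ≤ 0}

/-- The unit segment `[0, 1]`. -/
def unitSegment : Set ℂ := {z | height z = 0 ∧ 0 ≤ z.re ∧ z.re ≤ 1}

/-- The triangle the snowflake is built on. -/
def baseTriangle : Set ℂ := {z | height z ≤ 0 ∧ -(3 * z.re) ≤ height z ∧ 3 * z.re - 3 ≤ height z}

/-- The region enclosed by the `n`-th polygonal approximation of the snowflake. -/
def polygon (n : ℕ) : Set ℂ := baseTriangle ∪ ⋃ i : Fin 3, sideMap i '' cap n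

/-- The `n`-th stage of the covering of the snowflake by triangles. -/
def stage (n : ℕ) : Set ℂ := ⋃ i : Fin 3, sideMap i '' kochStage n

lemma mem_cap_succ {n : ℕ} {z : ℂ} :
    z ∈ cap (n + 1) ↔ z ∈ bump ∨ ∃ i, ∃ w ∈ cap n, kochMap i w = z := by
  simp [cap]

lemma mem_polygon {n : ℕ} {z : ℂ} :
    z ∈ polygon n ↔ z ∈ baseTriangle ∨ ∃ i, ∃ w ∈ cap n, sideMap i w = z := by
  simp [polygon]

lemma mem_stage {n : ℕ} {z : ℂ} : z ∈ stage n ↔ ∃ i, ∃ w ∈ kochStage n, sideMap i w = z := by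
  simp [stage]

lemma kochMap_image_cap_subset (i : Fin 4) (n : ℕ) : kochMap i '' cap n ⊆ cap (n + 1) :=
  fun _ ⟨w, hw, h⟩ => mem_cap_succ.2 (Or.inr ⟨i, w, hw, h⟩)

lemma bump_subset_cap (n : ℕ) : bump ⊆ cap (n + 1) := Set.subset_union_left

lemma cap_subset_succ (n : ℕ) : cap n ⊆ cap (n + 1) := by
  induction n with
  | zero => exact Set.empty_subset _
  | succ n ih =>
    intro z hz
    rcases mem_cap_succ.1 hz with h | ⟨i, w, hw, rfl⟩
    · exact bump_subset_cap _ h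
    · exact mem_cap_succ.2 (Or.inr ⟨i, w, ih hw, rfl⟩)

lemma cap_mono : Monotone cap := monotone_nat_of_le_succ cap_subset_succ

lemma cap_subset_kochStage_zero (n : ℕ) : cap n ⊆ kochStage 0 := by
  induction n with
  | zero => exact Set.empty_subset _
  | succ n ih =>
    intro z hz
    rcases mem_cap_succ.1 hz with ⟨h1, h2, h3⟩ | ⟨i, w, hw, rfl⟩
    · exact mem_kochStage_zero.2 ⟨h1, by linarith, by linarith⟩
    · exact kochMap_mem_kochStage_zero i (ih hw)

/-- What is added after step `n` sits in triangles of generation `n`. The first `bump` is common to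
both caps, so one map can be peeled off at each step of the induction. -/
lemma cap_diff_subset (n k : ℕ) : cap (n + k) \ cap n ⊆ kochStage n := by
  induction n with
  | zero => exact Set.sdiff_subset.trans (cap_subset_kochStage_zero _)
  | succ n ih =>
    rintro z ⟨hz, hz'⟩
    rw [add_right_comm, mem_cap_succ] at hz
    rw [mem_cap_succ] at hz'
    push Not at hz'
    obtain ⟨i, w, hw, rfl⟩ := hz.resolve_left hz'.1
    exact kochMap_mem_kochStage i (ih ⟨hw, fun h => hz'.2 i w h rfl⟩)

lemma kochMap_mem_interior (i : Fin 4) {s t : Set ℂ} {z : ℂ} (hz : z ∈ interior s)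
    (hst : kochMap i '' s ⊆ t) : kochMap i z ∈ interior t :=
  interior_mono hst (image_kochMap_interior i s ▸ Set.mem_image_of_mem _ hz)

lemma sideMap_mem_interior (i : Fin 3) {s t : Set ℂ} {z : ℂ} (hz : z ∈ interior s)
    (hst : sideMap i '' s ⊆ t) : sideMap i z ∈ interior t :=
  interior_mono hst (image_sideMap_interior i s ▸ Set.mem_image_of_mem _ hz)

/-- A point interior to a set is interior to any set containing it up to a neighbourhood. -/
lemma mem_interior_of_inter_subset {s t o : Set ℂ} {z : ℂ} (hz : z ∈ interior s) (ho : IsOpen o)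
    (hzo : z ∈ o) (h : s ∩ o ⊆ t) : z ∈ interior t := by
  refine interior_mono h ?_
  rw [interior_inter, ho.interior_eq]
  exact ⟨hz, hzo⟩

lemma isOpen_of_lt {a b c d e g : ℝ} :
    IsOpen {z : ℂ | a * z.re + b * height z + c < 0 ∧ d * z.re + e * height z + g < 0} := by
  have := continuous_height
  have h : ∀ a b c : ℝ, IsOpen {z : ℂ | a * z.re + b * height z + c < 0} := fun a b c =>
    isOpen_lt (by fun_prop) continuous_const
  exact (h a b c).inter (h d e g)

lemma re_pos_of_notMem {n : ℕ} {z : ℂ} (hz : z ∈ unitSegment) (hn : z ∉ kochStage n) :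
    0 < z.re ∧ z.re < 1 := by
  obtain ⟨h1, h2, h3⟩ := hz
  rw [height_eq_zero] at h1
  refine ⟨lt_of_le_of_ne h2 fun h => hn ?_, lt_of_le_of_ne h3 fun h => hn ?_⟩
  · rw [show z = 0 from Complex.ext h.symm h1]; exact zero_mem_kochStage n
  · rw [show z = 1 from Complex.ext h h1]; exact one_mem_kochStage n

lemma exists_kochMap_eq (i : Fin 4) (z : ℂ) : ∃ w, kochMap i w = z :=
  coe_kochHomeo i ▸ (kochHomeo i).surjective z

/-- There is no gap between the base line and the cap away from the covering triangles. The outer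
thirds reduce to the previous generation, since maps `0` and `3` preserve the lower half plane; over
the open middle third the bump fills the upper side. -/
lemma mem_interior_lowerPlane_union_cap {n : ℕ} {z : ℂ} (hz : z ∈ unitSegment)
    (hn : z ∉ kochStage n) : z ∈ interior (lowerPlane ∪ cap n) := by
  induction n generalizing z with
  | zero =>
    obtain ⟨h1, h2, h3⟩ := hz
    exact absurd (mem_kochStage_zero.2 ⟨h1.ge, by linarith, by linarith⟩) hn
  | succ n ih =>
    have hlow : ∀ i : Fin 4, (∀ w, height (kochMap i w) = height w / 3) →
        kochMap i '' (lowerPlane ∪ cap n) ⊆ lowerPlane ∪ cap (n + 1) := by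
      intro i hi
      rw [Set.image_union]
      refine Set.union_subset_union ?_ (kochMap_image_cap_subset i n)
      rintro _ ⟨w, hw, rfl⟩
      have hw' : height w ≤ 0 := hw
      have := hi w
      change height _ ≤ 0
      linarith
    obtain ⟨h1, h2, h3⟩ := hz
    rcases le_or_gt z.re (1 / 3) with h | h
    · obtain ⟨w, rfl⟩ := exists_kochMap_eq 0 z
      obtain ⟨e1, e2⟩ := kochMap_zero_coord w
      exact kochMap_mem_interior 0
        (ih ⟨by linarith, by linarith, by linarith⟩ fun h' => hn (kochMap_mem_kochStage 0 h'))
        (hlow 0 fun w => (kochMap_zero_coord w).2)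
    rcases le_or_gt (2 / 3) z.re with h' | h'
    · obtain ⟨w, rfl⟩ := exists_kochMap_eq 3 z
      obtain ⟨e1, e2⟩ := kochMap_three_coord w
      exact kochMap_mem_interior 3
        (ih ⟨by linarith, by linarith, by linarith⟩ fun h' => hn (kochMap_mem_kochStage 3 h'))
        (hlow 3 fun w => (kochMap_three_coord w).2)
    · refine mem_interior.2 ⟨_, ?_, isOpen_of_lt (a := -3) (b := 1) (c := 1) (d := 3) (e := 1)
        (g := -2), by linarith, by linarith⟩
      rintro w ⟨hw1, hw2⟩
      rcases le_or_gt (height w) 0 with h0 | h0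
      · exact Or.inl h0
      · exact Or.inr (bump_subset_cap n ⟨h0.le, by linarith, by linarith⟩)

/-- Here the small cap is glued to the left side of the bump: near that side, the image of the lower
half plane lies in the bump. -/
lemma kochMap_one_mem_interior_cap {n : ℕ} {z : ℂ} (hz : z ∈ unitSegment)
    (hn : z ∉ kochStage n) : kochMap 1 z ∈ interior (cap (n + 1)) := by
  have hin := mem_interior_lowerPlane_union_cap hz hn
  obtain ⟨r1, r2⟩ := re_pos_of_notMem hz hn
  obtain ⟨e1, e2⟩ := kochMap_one_coord z
  have h1 : height z = 0 := hz.1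
  refine mem_interior_of_inter_subset (kochMap_mem_interior 1 hin subset_rfl)
    (isOpen_of_lt (a := 0) (b := -1) (c := 0) (d := 3) (e := 1) (g := -2))
    ⟨by linarith, by linarith⟩ ?_
  rintro _ ⟨⟨w, hw | hw, rfl⟩, h3, h4⟩
  · obtain ⟨g1, g2⟩ := kochMap_one_coord w
    have : height w ≤ 0 := hw
    exact bump_subset_cap n ⟨by linarith, by linarith, by linarith⟩
  · exact kochMap_image_cap_subset 1 n ⟨w, hw, rfl⟩

lemma kochMap_two_mem_interior_cap {n : ℕ} {z : ℂ} (hz : z ∈ unitSegment)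
    (hn : z ∉ kochStage n) : kochMap 2 z ∈ interior (cap (n + 1)) := by
  have hin := mem_interior_lowerPlane_union_cap hz hn
  obtain ⟨r1, r2⟩ := re_pos_of_notMem hz hn
  obtain ⟨e1, e2⟩ := kochMap_two_coord z
  have h1 : height z = 0 := hz.1
  refine mem_interior_of_inter_subset (kochMap_mem_interior 2 hin subset_rfl)
    (isOpen_of_lt (a := 0) (b := -1) (c := 0) (d := -3) (e := 1) (g := 1))
    ⟨by linarith, by linarith⟩ ?_
  rintro _ ⟨⟨w, hw | hw, rfl⟩, h3, h4⟩
  · obtain ⟨g1, g2⟩ := kochMap_two_coord w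
    have : height w ≤ 0 := hw
    exact bump_subset_cap n ⟨by linarith, by linarith, by linarith⟩
  · exact kochMap_image_cap_subset 2 n ⟨w, hw, rfl⟩

/-- The only free edge of a cap, off the covering triangles, is its base. The two slanted sides of
the bump are closed up by caps of the next generation; in smaller copies the base goes to the base
under maps `0` and `3`, and to a glued side under maps `1` and `2`. -/
lemma mem_interior_cap_or_mem_unitSegment {n : ℕ} {z : ℂ} (hz : z ∈ cap n)
    (hn : z ∉ kochStage n) : z ∈ interior (cap n) ∨ z ∈ unitSegment := by
  induction n generalizing z with
  | zero => exact absurd hz (Set.notMem_empty _)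
  | succ n ih =>
    rcases mem_cap_succ.1 hz with ⟨h1, h2, h3⟩ | ⟨i, w, hw, rfl⟩
    · rcases h1.eq_or_lt with h1 | h1
      · exact Or.inr ⟨h1.symm, by linarith, by linarith⟩
      rcases h2.eq_or_lt with h2 | h2
      · obtain ⟨w, rfl⟩ := exists_kochMap_eq 1 z
        obtain ⟨e1, e2⟩ := kochMap_one_coord w
        exact Or.inl (kochMap_one_mem_interior_cap ⟨by linarith, by linarith, by linarith⟩
          fun h => hn (kochMap_mem_kochStage 1 h))
      rcases h3.eq_or_lt with h3 | h3
      · obtain ⟨w, rfl⟩ := exists_kochMap_eq 2 z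
        obtain ⟨e1, e2⟩ := kochMap_two_coord w
        exact Or.inl (kochMap_two_mem_interior_cap ⟨by linarith, by linarith, by linarith⟩
          fun h => hn (kochMap_mem_kochStage 2 h))
      · refine Or.inl (mem_interior.2 ⟨_, ?_, (isOpen_of_lt (a := -3) (b := 1) (c := 1) (d := 3)
          (e := 1) (g := -2)).inter (isOpen_of_lt (a := 0) (b := -1) (c := 0) (d := 0)
          (e := -1) (g := 0)), ⟨by linarith, by linarith⟩, ⟨by linarith, by linarith⟩⟩)
        rintro w ⟨⟨h4, h5⟩, h6, _⟩
        exact bump_subset_cap n ⟨by linarith, by linarith, by linarith⟩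
    · have hw' : w ∉ kochStage n := fun h => hn (kochMap_mem_kochStage i h)
      rcases ih hw hw' with h | h
      · exact Or.inl (kochMap_mem_interior i h (kochMap_image_cap_subset i n))
      · have h' := h
        obtain ⟨h1, h2, h3⟩ := h'
        revert i
        apply forall_fin_four
        · intro _ _
          obtain ⟨e1, e2⟩ := kochMap_zero_coord w
          exact Or.inr ⟨by linarith, by linarith, by linarith⟩
        · intro _ _
          exact Or.inl (kochMap_one_mem_interior_cap h hw')
        · intro _ _
          exact Or.inl (kochMap_two_mem_interior_cap h hw')
        · intro _ _
          obtain ⟨e1, e2⟩ := kochMap_three_coord w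
          exact Or.inr ⟨by linarith, by linarith, by linarith⟩

lemma isCompact_bump : IsCompact bump := by
  refine (isCompact_kochStage 0).of_isClosed_subset ?_
    ((bump_subset_cap 0).trans (cap_subset_kochStage_zero 1))
  have := continuous_height
  have h1 : IsClosed {z : ℂ | 0 ≤ height z} := isClosed_le (by fun_prop) (by fun_prop)
  have h2 : IsClosed {z : ℂ | height z ≤ 3 * z.re - 1} := isClosed_le (by fun_prop) (by fun_prop)
  have h3 : IsClosed {z : ℂ | height z ≤ 2 - 3 * z.re} := isClosed_le (by fun_prop) (by fun_prop)
  exact h1.inter (h2.inter h3)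

lemma isCompact_cap (n : ℕ) : IsCompact (cap n) := by
  induction n with
  | zero => exact isCompact_empty
  | succ n ih =>
    exact isCompact_bump.union (isCompact_iUnion fun i => ih.image (continuous_kochMap i))

lemma isClosed_baseTriangle : IsClosed baseTriangle := by
  have := continuous_height
  have h1 : IsClosed {z : ℂ | height z ≤ 0} := isClosed_le (by fun_prop) (by fun_prop)
  have h2 : IsClosed {z : ℂ | -(3 * z.re) ≤ height z} := isClosed_le (by fun_prop) (by fun_prop)
  have h3 : IsClosed {z : ℂ | 3 * z.re - 3 ≤ height z} := isClosed_le (by fun_prop) (by fun_prop)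
  exact h1.inter (h2.inter h3)

lemma isClosed_polygon (n : ℕ) : IsClosed (polygon n) :=
  isClosed_baseTriangle.union
    (isCompact_iUnion fun i => (isCompact_cap n).image (continuous_sideMap i)).isClosed

lemma isClosed_stage (n : ℕ) : IsClosed (stage n) :=
  (isCompact_iUnion fun i => (isCompact_kochStage n).image (continuous_sideMap i)).isClosed

lemma sideMap_image_cap_subset (i : Fin 3) (n : ℕ) : sideMap i '' cap n ⊆ polygon n :=
  fun _ ⟨w, hw, h⟩ => mem_polygon.2 (Or.inr ⟨i, w, hw, h⟩)

/-- The same gluing along a side of the base triangle, which near that side agrees with the image of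
the lower half plane. -/
lemma sideMap_mem_interior_polygon (i : Fin 3) {n : ℕ} {z : ℂ} (hz : z ∈ unitSegment)
    (hn : z ∉ kochStage n) : sideMap i z ∈ interior (polygon n) := by
  have hin := mem_interior_lowerPlane_union_cap hz hn
  obtain ⟨r1, r2⟩ := re_pos_of_notMem hz hn
  have h1 : height z = 0 := hz.1
  revert i
  apply forall_fin_three
  · refine mem_interior_of_inter_subset (sideMap_mem_interior 0 hin subset_rfl)
      (isOpen_of_lt (a := -3) (b := -1) (c := 0) (d := 3) (e := -1) (g := -3))
      ⟨?_, ?_⟩ ?_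
    · have := sideMap_zero_coord z; linarith
    · have := sideMap_zero_coord z; linarith
    rintro _ ⟨⟨w, hw | hw, rfl⟩, h3, h4⟩
    · obtain ⟨g1, g2⟩ := sideMap_zero_coord w
      have : height w ≤ 0 := hw
      exact Or.inl ⟨by linarith, by linarith, by linarith⟩
    · exact sideMap_image_cap_subset 0 n ⟨w, hw, rfl⟩
  · obtain ⟨e1, e2⟩ := sideMap_one_coord z
    refine mem_interior_of_inter_subset (sideMap_mem_interior 1 hin subset_rfl)
      (isOpen_of_lt (a := -3) (b := -1) (c := 0) (d := 0) (e := 1) (g := 0))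
      ⟨by linarith, by linarith⟩ ?_
    rintro _ ⟨⟨w, hw | hw, rfl⟩, h3, h4⟩
    · obtain ⟨g1, g2⟩ := sideMap_one_coord w
      have : height w ≤ 0 := hw
      exact Or.inl ⟨by linarith, by linarith, by linarith⟩
    · exact sideMap_image_cap_subset 1 n ⟨w, hw, rfl⟩
  · obtain ⟨e1, e2⟩ := sideMap_two_coord z
    refine mem_interior_of_inter_subset (sideMap_mem_interior 2 hin subset_rfl)
      (isOpen_of_lt (a := 3) (b := -1) (c := -3) (d := 0) (e := 1) (g := 0))
      ⟨by linarith, by linarith⟩ ?_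
    rintro _ ⟨⟨w, hw | hw, rfl⟩, h3, h4⟩
    · obtain ⟨g1, g2⟩ := sideMap_two_coord w
      have : height w ≤ 0 := hw
      exact Or.inl ⟨by linarith, by linarith, by linarith⟩
    · exact sideMap_image_cap_subset 2 n ⟨w, hw, rfl⟩

lemma exists_sideMap_eq (i : Fin 3) (z : ℂ) : ∃ w, sideMap i w = z :=
  coe_sideHomeo i ▸ (sideHomeo i).surjective z

lemma mem_interior_polygon {n : ℕ} {z : ℂ} (hz : z ∈ polygon n) (hn : z ∉ stage n) :
    z ∈ interior (polygon n) := by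
  have hn' : ∀ i w, sideMap i w = z → w ∉ kochStage n :=
    fun i w hw h => hn (mem_stage.2 ⟨i, w, h, hw⟩)
  rcases mem_polygon.1 hz with ⟨h1, h2, h3⟩ | ⟨i, w, hw, rfl⟩
  · rcases h1.eq_or_lt with h1 | h1
    · obtain ⟨w, rfl⟩ := exists_sideMap_eq 0 z
      obtain ⟨e1, e2⟩ := sideMap_zero_coord w
      exact sideMap_mem_interior_polygon 0 ⟨by linarith, by linarith, by linarith⟩ (hn' 0 w rfl)
    rcases h2.eq_or_lt with h2 | h2
    · obtain ⟨w, rfl⟩ := exists_sideMap_eq 2 z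
      obtain ⟨e1, e2⟩ := sideMap_two_coord w
      exact sideMap_mem_interior_polygon 2 ⟨by linarith, by linarith, by linarith⟩ (hn' 2 w rfl)
    rcases h3.eq_or_lt with h3 | h3
    · obtain ⟨w, rfl⟩ := exists_sideMap_eq 1 z
      obtain ⟨e1, e2⟩ := sideMap_one_coord w
      exact sideMap_mem_interior_polygon 1 ⟨by linarith, by linarith, by linarith⟩ (hn' 1 w rfl)
    · refine mem_interior.2 ⟨_, ?_, (isOpen_of_lt (a := -3) (b := -1) (c := 0) (d := 3)
          (e := -1) (g := -3)).inter (isOpen_of_lt (a := 0) (b := 1) (c := 0) (d := 0)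
          (e := 1) (g := 0)), ⟨by linarith, by linarith⟩, ⟨by linarith, by linarith⟩⟩
      rintro w ⟨⟨h4, h5⟩, h6, _⟩
      exact Or.inl ⟨by linarith, by linarith, by linarith⟩
  · rcases mem_interior_cap_or_mem_unitSegment hw (hn' i w rfl) with h | h
    · exact sideMap_mem_interior i h (sideMap_image_cap_subset i n)
    · exact sideMap_mem_interior_polygon i h (hn' i w rfl)

lemma polygon_diff_subset {m : ℕ} (n : ℕ) : polygon m \ polygon n ⊆ stage n := by
  rintro z ⟨hz, hz'⟩
  rw [mem_polygon] at hz'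
  push Not at hz'
  obtain ⟨i, w, hw, rfl⟩ := (mem_polygon.1 hz).resolve_left hz'.1
  -- Enlarging `cap m` to `cap (n + m)` avoids comparing `m` with `n`.
  exact mem_stage.2 ⟨i, w, cap_diff_subset n m
    ⟨cap_mono (Nat.le_add_left m n) hw, fun h => hz'.2 i w h rfl⟩, rfl⟩

/-- A point missed by each of the three sides at some generation is missed by all of them at the
largest of these, because the stages decrease. -/
lemma iInter_stage_subset : ⋂ n, stage n ⊆ curve := by
  intro z hz
  rw [Set.mem_iInter] at hz
  by_contra hcon
  have h : ∀ i : Fin 3, ∃ n, ∀ w ∈ kochStage n, sideMap i w ≠ z := by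
    intro i
    by_contra! h
    obtain ⟨w, hw⟩ := exists_sideMap_eq i z
    refine hcon (Set.mem_iUnion.2 ⟨i, w, Set.mem_iInter.2 fun n => ?_, hw⟩)
    obtain ⟨w', hw', h'⟩ := h n
    rwa [(isometry_sideMap i).injective (hw.trans h'.symm)]
  choose N hN using h
  obtain ⟨i, w, hw, h⟩ := mem_stage.1 (hz (Finset.univ.sup N))
  exact hN i w (kochStage_antitone (Finset.le_sup (Finset.mem_univ i)) hw) h

/-- The union of the polygons inscribed in the snowflake. -/
def polygonUnion : Set ℂ := ⋃ n, polygon n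

/-- Off the closed set `stage n` the union coincides with the closed set `polygon n`, all of whose
points there are interior. A frontier point thus lies in every stage. -/
lemma frontier_polygonUnion_subset : frontier polygonUnion ⊆ curve := by
  refine subset_trans (fun z hz => Set.mem_iInter.2 fun n => ?_) iInter_stage_subset
  by_contra hn
  have hz1 : z ∈ polygon n := by
    have h1 : z ∈ closure (polygonUnion ∩ (stage n)ᶜ) :=
      (isClosed_stage n).isOpen_compl.closure_inter ⟨hz.1, hn⟩
    rw [← (isClosed_polygon n).closure_eq]
    refine closure_mono ?_ h1
    rintro w ⟨hw, hw'⟩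
    obtain ⟨m, hm⟩ := Set.mem_iUnion.1 hw
    by_contra h
    exact hw' (polygon_diff_subset n ⟨hm, h⟩)
  exact hz.2 (interior_mono (Set.subset_iUnion polygon n) (mem_interior_polygon hz1 hn))

/-! ### Cells, finite Hausdorff measure and zero area -/

/-- The similarity of ratio `3⁻ⁿ` indexed by a word of length `n`. -/
def cellMap : (n : ℕ) → (Fin n → Fin 4) → ℂ → ℂ
  | 0, _, z => z
  | n + 1, w, z => kochMap (w 0) (cellMap n (Fin.tail w) z)

lemma norm_cellMap_sub {n : ℕ} (w : Fin n → Fin 4) (x y : ℂ) :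
    ‖cellMap n w x - cellMap n w y‖ = ‖x - y‖ / 3 ^ n := by
  induction n with
  | zero => simp [cellMap]
  | succ n ih =>
    rw [cellMap, cellMap, norm_kochMap_sub, ih, pow_succ, div_div]

lemma exists_cellMap_eq {n : ℕ} {z : ℂ} (hz : z ∈ kochStage n) :
    ∃ w, ∃ x ∈ kochStage 0, cellMap n w x = z := by
  induction n generalizing z with
  | zero => exact ⟨Fin.elim0, z, hz, rfl⟩
  | succ n ih =>
    obtain ⟨i, y, hy, rfl⟩ := mem_kochStage_succ.1 hz
    obtain ⟨w, x, hx, rfl⟩ := ih hy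
    exact ⟨Fin.cons i w, x, hx, by simp [cellMap]⟩

lemma kochCurve_subset_iUnion (n : ℕ) : kochCurve ⊆ ⋃ w, cellMap n w '' kochStage 0 := by
  intro z hz
  obtain ⟨w, x, hx, h⟩ := exists_cellMap_eq (Set.mem_iInter.1 hz n)
  exact Set.mem_iUnion.2 ⟨w, x, hx, h⟩

lemma ediam_cell_le {n : ℕ} (w : Fin n → Fin 4) :
    Metric.ediam (cellMap n w '' kochStage 0) ≤ ENNReal.ofReal (2 / 3 ^ n) := by
  refine Metric.ediam_le ?_
  rintro _ ⟨x, hx, rfl⟩ _ ⟨y, hy, rfl⟩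
  rw [edist_dist, dist_eq_norm, norm_cellMap_sub]
  have := norm_sub_le_of_mem_kochStage_zero hx hy
  gcongr

lemma dimension_pos : 0 < dimension :=
  div_pos (Real.log_pos (by norm_num)) (Real.log_pos (by norm_num))

lemma three_rpow_dimension : (3 : ℝ) ^ dimension = 4 := by
  rw [Real.rpow_def_of_pos (by norm_num), dimension, mul_div_cancel₀]
  · exact Real.exp_log (by norm_num)
  · exact (Real.log_pos (by norm_num)).ne'

lemma div_three_pow_rpow_dimension {a : ℝ} (ha : 0 ≤ a) (n : ℕ) :
    (a / 3 ^ n) ^ dimension = a ^ dimension / 4 ^ n := by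
  rw [Real.div_rpow ha (by positivity), ← Real.rpow_natCast 3 n, ← Real.rpow_mul (by norm_num),
    mul_comm, Real.rpow_mul (by norm_num), three_rpow_dimension, Real.rpow_natCast]

lemma tendsto_div_pow_zero {a b : ℝ} (hb : 1 < b) :
    Tendsto (fun n : ℕ => ENNReal.ofReal (a / b ^ n)) atTop (𝓝 0) := by
  rw [← ENNReal.ofReal_zero]
  refine ENNReal.tendsto_ofReal ?_
  simpa using (tendsto_const_nhds (x := a)).div_atTop (tendsto_pow_atTop_atTop_of_one_lt hb)

/-- The `4 ^ n` cells of diameter at most `2 / 3 ^ n` contribute `4 ^ n * (2 / 3 ^ n) ^ dimension =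
2 ^ dimension`, because `3 ^ dimension = 4`. -/
lemma hausdorffMeasure_kochCurve_lt_top : Measure.hausdorffMeasure dimension kochCurve < ⊤ := by
  refine ((Measure.hausdorffMeasure_le_liminf_sum (l := atTop) dimension kochCurve
    (fun n : ℕ => ENNReal.ofReal (2 / 3 ^ n)) (tendsto_div_pow_zero (by norm_num))
    (fun n w => cellMap n w '' kochStage 0) (Eventually.of_forall fun n w => ediam_cell_le w)
    (Eventually.of_forall kochCurve_subset_iUnion)).trans ?_).trans_lt
      (ENNReal.ofReal_lt_top (r := (2 : ℝ) ^ dimension))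
  refine liminf_le_of_le (by isBoundedDefault) fun b hb => ?_
  obtain ⟨n, hn⟩ := hb.exists
  refine hn.trans ((Finset.sum_le_sum fun w _ =>
    ENNReal.rpow_le_rpow (ediam_cell_le w) dimension_pos.le).trans_eq ?_)
  rw [ENNReal.ofReal_rpow_of_nonneg (by positivity) dimension_pos.le,
    div_three_pow_rpow_dimension (by norm_num), Finset.sum_const, nsmul_eq_mul,
    ← ENNReal.ofReal_natCast, ← ENNReal.ofReal_mul (by positivity)]
  congr 1
  simp
  field_simp

/-- The curve is covered by `4 ^ n` discs of radius `2 / 3 ^ n`, of total area `4 π (4 / 9) ^ n`. -/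
lemma volume_side (i : Fin 3) : volume (side i) = 0 := by
  have h : ∀ n : ℕ, volume (side i) ≤ ENNReal.ofReal (4 * Real.pi / (9 / 4) ^ n) := by
    intro n
    have hsub : side i ⊆ ⋃ w : Fin n → Fin 4,
        Metric.closedBall (sideMap i (cellMap n w 0)) (2 / 3 ^ n) := by
      rintro _ ⟨z, hz, rfl⟩
      obtain ⟨w, x, hx, rfl⟩ := exists_cellMap_eq (Set.mem_iInter.1 hz n)
      refine Set.mem_iUnion.2 ⟨w, ?_⟩
      rw [Metric.mem_closedBall, dist_eq_norm, norm_sideMap_sub, norm_cellMap_sub]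
      have := norm_sub_le_of_mem_kochStage_zero hx (zero_mem_kochStage 0)
      gcongr
    refine (measure_mono hsub).trans ((measure_iUnion_le _).trans_eq ?_)
    simp only [Complex.volume_closedBall]
    rw [tsum_fintype, Finset.sum_const, nsmul_eq_mul, ← ENNReal.ofReal_pow (by positivity),
      ← ENNReal.ofReal_coe_nnreal, ← ENNReal.ofReal_mul (by positivity), ← ENNReal.ofReal_natCast,
      ← ENNReal.ofReal_mul (by positivity)]
    congr 1
    have h9 : (9 : ℝ) ^ n = 3 ^ n * 3 ^ n := by rw [← mul_pow]; norm_num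
    simp only [Finset.card_univ, Fintype.card_fun, Fintype.card_fin, Nat.cast_pow, Nat.cast_ofNat,
      NNReal.coe_real_pi, div_pow, h9]
    field_simp
    norm_num
  exact le_antisymm (ge_of_tendsto' (tendsto_div_pow_zero (by norm_num)) h) zero_le

lemma volume_curve : volume curve = 0 := measure_iUnion_null volume_side

/-! ### Interior balls and separation of cells -/

/-- The centre of the triangle `bump`. -/
def center : ℂ := ⟨1 / 2, √3 / 18⟩

lemma abs_height_sub_le (z w : ℂ) : |height z - height w| ≤ 2 * ‖z - w‖ := by
  have h1 : height z - height w = √3 * (z - w).im := by simp [height]; ring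
  rw [h1, abs_mul, abs_of_nonneg (Real.sqrt_nonneg _)]
  have h2 : √(3 : ℝ) ≤ 2 := by rw [Real.sqrt_le_left (by norm_num)]; norm_num
  exact mul_le_mul h2 (Complex.abs_im_le_norm _) (abs_nonneg _) (by norm_num)

lemma mem_ball_center {z : ℂ} (hz : z ∈ Metric.ball center (1 / 20)) :
    1 / 15 < height z ∧ height z < 4 / 15 ∧ 9 / 20 < z.re ∧ z.re < 11 / 20 := by
  rw [Metric.mem_ball, dist_eq_norm] at hz
  have h1 := abs_height_sub_le z center
  have h2 := Complex.abs_re_le_norm (z - center)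
  have h3 : height center = 1 / 6 := by
    simp only [height, center]; linarith [sqrt_three_mul_self]
  rw [Complex.sub_re, show center.re = 1 / 2 from rfl, abs_le] at h2
  rw [h3, abs_le] at h1
  refine ⟨by linarith, by linarith, by linarith, by linarith⟩

lemma ball_center_subset_bump : Metric.ball center (1 / 20) ⊆ bump := fun z hz => by
  obtain ⟨h1, h2, h3, h4⟩ := mem_ball_center hz
  exact ⟨by linarith, by linarith, by linarith⟩

lemma center_mem_kochStage_zero : center ∈ kochStage 0 := by
  obtain ⟨h1, h2, h3, h4⟩ := mem_ball_center (Metric.mem_ball_self (x := center) (by norm_num))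
  exact mem_kochStage_zero.2 ⟨by linarith, by linarith, by linarith⟩

/-- Every covering triangle of generation `n` carries its own scaled copy of the bump, hence of a
fixed ball. This interior ball condition is the source of the measure density. -/
lemma exists_ball_subset_cap {n : ℕ} {z : ℂ} (hz : z ∈ kochStage n) :
    ∃ y, ‖z - y‖ ≤ 2 / 3 ^ n ∧ Metric.ball y (1 / 20 / 3 ^ n) ⊆ cap (n + 1) := by
  induction n generalizing z with
  | zero =>
    refine ⟨center, ?_, ?_⟩
    · simpa using norm_sub_le_of_mem_kochStage_zero hz center_mem_kochStage_zero
    · simpa using ball_center_subset_bump.trans (bump_subset_cap 0)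
  | succ n ih =>
    obtain ⟨i, x, hx, rfl⟩ := mem_kochStage_succ.1 hz
    obtain ⟨y, hy1, hy2⟩ := ih hx
    refine ⟨kochMap i y, ?_, ?_⟩
    · rw [norm_kochMap_sub, pow_succ, ← div_div]
      gcongr
    · rw [pow_succ, ← div_div, ← kochMap_image_ball]
      exact (Set.image_mono hy2).trans (kochMap_image_cap_subset i (n + 1))

/-- The interior of the triangle `kochStage 0`. -/
def openTriangle : Set ℂ := {z | 0 < height z ∧ height z < z.re ∧ height z < 1 - z.re}

lemma ball_center_subset_openTriangle : Metric.ball center (1 / 20) ⊆ openTriangle := fun z hz => by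
  obtain ⟨h1, h2, h3, h4⟩ := mem_ball_center hz
  exact ⟨by linarith, by linarith, by linarith⟩

/-- This is the open set condition: the four images lie in disjoint vertical strips, so disjointness
can be read off from real parts. -/
lemma kochMap_mem_openTriangle (i : Fin 4) {z : ℂ} (hz : z ∈ openTriangle) :
    kochMap i z ∈ openTriangle ∧ (![0, 1 / 3, 1 / 2, 2 / 3] : Fin 4 → ℝ) i < (kochMap i z).re ∧
      (kochMap i z).re < (![1 / 3, 1 / 2, 2 / 3, 1] : Fin 4 → ℝ) i := by
  obtain ⟨h1, h2, h3⟩ := hz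
  revert i
  apply forall_fin_four
  · obtain ⟨e1, e2⟩ := kochMap_zero_coord z
    refine ⟨⟨?_, ?_, ?_⟩, ?_, ?_⟩ <;> simp [e1, e2] <;> linarith
  · obtain ⟨e1, e2⟩ := kochMap_one_coord z
    refine ⟨⟨?_, ?_, ?_⟩, ?_, ?_⟩ <;> simp [e1, e2] <;> linarith
  · obtain ⟨e1, e2⟩ := kochMap_two_coord z
    refine ⟨⟨?_, ?_, ?_⟩, ?_, ?_⟩ <;> simp [e1, e2] <;> linarith
  · obtain ⟨e1, e2⟩ := kochMap_three_coord z
    refine ⟨⟨?_, ?_, ?_⟩, ?_, ?_⟩ <;> simp [e1, e2] <;> linarith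

lemma kochMap_ne_of_ne {i j : Fin 4} (hij : i ≠ j) {x y : ℂ} (hx : x ∈ openTriangle)
    (hy : y ∈ openTriangle) : kochMap i x ≠ kochMap j y := by
  intro h
  obtain ⟨-, h1, h2⟩ := kochMap_mem_openTriangle i hx
  obtain ⟨-, h3, h4⟩ := kochMap_mem_openTriangle j hy
  rw [h] at h1 h2
  generalize (kochMap j y).re = t at *
  fin_cases i <;> fin_cases j <;> simp at hij h1 h2 h3 h4 <;> linarith

lemma cellMap_mem_openTriangle {n : ℕ} (w : Fin n → Fin 4) {z : ℂ} (hz : z ∈ openTriangle) :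
    cellMap n w z ∈ openTriangle := by
  induction n with
  | zero => exact hz
  | succ n ih => exact (kochMap_mem_openTriangle _ (ih _)).1

lemma eq_of_cellMap_eq {n : ℕ} {v w : Fin n → Fin 4} {x y : ℂ} (hx : x ∈ openTriangle)
    (hy : y ∈ openTriangle) (h : cellMap n v x = cellMap n w y) : v = w := by
  induction n with
  | zero => exact Subsingleton.elim _ _
  | succ n ih =>
    have h0 : v 0 = w 0 := by
      by_contra h0
      exact kochMap_ne_of_ne h0 (cellMap_mem_openTriangle _ hx) (cellMap_mem_openTriangle _ hy) h
    rw [cellMap, cellMap, h0] at h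
    rw [← Fin.cons_self_tail v, ← Fin.cons_self_tail w, h0, ih (kochMap_injective _ h)]

lemma cellMap_image_ball {n : ℕ} (w : Fin n → Fin 4) (y : ℂ) (r : ℝ) :
    cellMap n w '' Metric.ball y r = Metric.ball (cellMap n w y) (r / 3 ^ n) := by
  induction n with
  | zero => simp [cellMap]
  | succ n ih =>
    rw [pow_succ, ← div_div]
    change _ = Metric.ball (kochMap _ _) _
    rw [← kochMap_image_ball, ← ih, Set.image_image]
    rfl

lemma pairwise_disjoint_ball (n : ℕ) : Pairwise (Function.onFun Disjoint
    fun w : Fin n → Fin 4 => Metric.ball (cellMap n w center) (1 / 20 / 3 ^ n)) := by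
  intro v w hvw
  rw [Function.onFun, Set.disjoint_left]
  intro z hz hz'
  rw [← cellMap_image_ball] at hz hz'
  obtain ⟨x, hx, rfl⟩ := hz
  obtain ⟨y, hy, h⟩ := hz'
  exact hvw (eq_of_cellMap_eq (ball_center_subset_openTriangle hx)
    (ball_center_subset_openTriangle hy) h.symm)

/-- A set of diameter at most `3⁻ⁿ` meets a bounded number of cells of generation `n`. -/
lemma card_le_of_inter_nonempty {n : ℕ} {s : Set ℂ}
    (hs : Metric.ediam s ≤ ENNReal.ofReal (1 / 3 ^ n)) (F : Finset (Fin n → Fin 4))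
    (hF : ∀ w ∈ F, (cellMap n w '' kochStage 0 ∩ s).Nonempty) : F.card ≤ 6400 := by
  rcases F.eq_empty_or_nonempty with rfl | ⟨w₀, hw₀⟩
  · simp
  obtain ⟨x₀, -, hx₀⟩ := hF w₀ hw₀
  -- Area comparison: disjoint balls of radius `1 / 20 / 3 ^ n` inside one of radius `4 / 3 ^ n`
  -- number at most `80 ^ 2 = 6400`.
  have hsub : ⋃ w ∈ F, Metric.ball (cellMap n w center) (1 / 20 / 3 ^ n) ⊆
      Metric.ball x₀ (4 / 3 ^ n) := by
    refine Set.iUnion₂_subset fun w hw z hz => ?_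
    obtain ⟨_, ⟨x, hx, rfl⟩, hxs⟩ := hF w hw
    have h1 : ‖cellMap n w center - cellMap n w x‖ ≤ 2 / 3 ^ n := by
      rw [norm_cellMap_sub]
      have := norm_sub_le_of_mem_kochStage_zero center_mem_kochStage_zero hx
      gcongr
    have h2 : dist (cellMap n w x) x₀ ≤ 1 / 3 ^ n := by
      have := (Metric.edist_le_ediam_of_mem hxs hx₀).trans hs
      rwa [edist_dist, ENNReal.ofReal_le_ofReal_iff (by positivity)] at this
    rw [← dist_eq_norm] at h1
    rw [Metric.mem_ball] at hz ⊢
    have h3 := dist_triangle4 z (cellMap n w center) (cellMap n w x) x₀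
    have h4 : (1 : ℝ) / 20 / 3 ^ n < 1 / 3 ^ n := by gcongr; norm_num
    calc dist z x₀ < 1 / 3 ^ n + 2 / 3 ^ n + 1 / 3 ^ n := by linarith
      _ = 4 / 3 ^ n := by ring
  have hvol := measure_mono (μ := volume) hsub
  rw [measure_biUnion_finset ((pairwise_disjoint_ball n).set_pairwise _)
    fun _ _ => measurableSet_ball] at hvol
  simp only [Complex.volume_ball, Finset.sum_const, nsmul_eq_mul] at hvol
  rw [← ENNReal.ofReal_pow (by positivity), ← ENNReal.ofReal_pow (by positivity), ← mul_assoc,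
    ENNReal.mul_le_mul_iff_left (by simpa using NNReal.pi_ne_zero) (by simp),
    ← ENNReal.ofReal_natCast,
    ← ENNReal.ofReal_mul (by positivity), ENNReal.ofReal_le_ofReal_iff (by positivity)] at hvol
  have h5 : (0 : ℝ) < (1 / 3 ^ n) ^ 2 := by positivity
  have h6 : (F.card : ℝ) * (1 / 3 ^ n) ^ 2 ≤ 6400 * (1 / 3 ^ n) ^ 2 := by
    have e1 : (F.card : ℝ) * (1 / 20 / 3 ^ n) ^ 2 = F.card * (1 / 3 ^ n) ^ 2 / 400 := by ring
    have e2 : ((4 : ℝ) / 3 ^ n) ^ 2 = 16 * (1 / 3 ^ n) ^ 2 := by ring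
    rw [e1, e2] at hvol
    linarith
  exact_mod_cast le_of_mul_le_mul_right h6 h5

/-! ### Symbolic coding and positivity of the Hausdorff measure -/

/-- The partial sums of the coding of the Koch curve by sequences of indices. -/
def codePartial (N : ℕ) (ξ : ℕ → Fin 4) : ℂ :=
  ∑ n ∈ Finset.range N, (∏ j ∈ Finset.range n, kochRatio (ξ j)) * kochMap (ξ n) 0

/-- The coding of the Koch curve by sequences of indices. -/
def code (ξ : ℕ → Fin 4) : ℂ :=
  ∑' n, (∏ j ∈ Finset.range n, kochRatio (ξ j)) * kochMap (ξ n) 0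

lemma norm_code_term_le (ξ : ℕ → Fin 4) (n : ℕ) :
    ‖(∏ j ∈ Finset.range n, kochRatio (ξ j)) * kochMap (ξ n) 0‖ ≤ 2 * (1 / 3) ^ n := by
  have h : ‖kochMap (ξ n) 0‖ ≤ 2 := by
    simpa using norm_sub_le_of_mem_kochStage_zero
      (kochMap_mem_kochStage_zero (ξ n) (zero_mem_kochStage 0)) (zero_mem_kochStage 0)
  rw [norm_mul, norm_prod, mul_comm]
  simp only [norm_kochRatio, Finset.prod_const, Finset.card_range]
  gcongr

lemma summable_code_bound : Summable fun n : ℕ => 2 * (1 / 3 : ℝ) ^ n :=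
  (summable_geometric_of_lt_one (by norm_num) (by norm_num)).mul_left 2

lemma continuous_code : Continuous code := by
  refine continuous_tsum (fun n => ?_) summable_code_bound fun n ξ => norm_code_term_le ξ n
  refine (continuous_finsetProd _ fun j _ => ?_).mul ?_
  · exact continuous_of_discreteTopology.comp (continuous_apply j)
  · exact (continuous_of_discreteTopology (f := fun i => kochMap i 0)).comp (continuous_apply n)

lemma tendsto_codePartial (ξ : ℕ → Fin 4) :
    Tendsto (fun N => codePartial N ξ) atTop (𝓝 (code ξ)) :=
  (Summable.of_norm_bounded summable_code_bound (norm_code_term_le ξ)).hasSum.tendsto_sum_nat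

lemma codePartial_succ (N : ℕ) (ξ : ℕ → Fin 4) :
    codePartial (N + 1) ξ = kochMap (ξ 0) (codePartial N fun n => ξ (n + 1)) := by
  rw [kochMap_eq, codePartial, Finset.sum_range_succ', codePartial, Finset.mul_sum, add_comm]
  simp only [Finset.prod_range_succ', Finset.prod_range_zero, one_mul]
  congr 1
  exact Finset.sum_congr rfl fun n _ => by ring

/-- Shifting the sequence corresponds to one similarity, so membership in stages and cells follows
by induction on the generation. -/
lemma code_eq (ξ : ℕ → Fin 4) : code ξ = kochMap (ξ 0) (code fun n => ξ (n + 1)) := by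
  refine tendsto_nhds_unique ((tendsto_add_atTop_iff_nat 1).2 (tendsto_codePartial ξ)) ?_
  simp only [codePartial_succ]
  exact ((continuous_kochMap _).tendsto _).comp (tendsto_codePartial _)

lemma codePartial_mem (N : ℕ) (ξ : ℕ → Fin 4) : codePartial N ξ ∈ kochStage 0 := by
  induction N generalizing ξ with
  | zero => simpa [codePartial] using zero_mem_kochStage 0
  | succ N ih => rw [codePartial_succ]; exact kochMap_mem_kochStage_zero _ (ih _)

lemma code_mem_kochStage (n : ℕ) (ξ : ℕ → Fin 4) : code ξ ∈ kochStage n := by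
  induction n generalizing ξ with
  | zero =>
    exact (isCompact_kochStage 0).isClosed.mem_of_tendsto (tendsto_codePartial ξ)
      (Eventually.of_forall fun N => codePartial_mem N ξ)
  | succ n ih => rw [code_eq]; exact kochMap_mem_kochStage _ (ih _)

lemma code_mem_kochCurve (ξ : ℕ → Fin 4) : code ξ ∈ kochCurve :=
  Set.mem_iInter.2 fun n => code_mem_kochStage n ξ

lemma code_mem_cell (n : ℕ) (ξ : ℕ → Fin 4) :
    code ξ ∈ cellMap n (fun i => ξ i) '' kochStage 0 := by
  induction n generalizing ξ with
  | zero => exact ⟨code ξ, code_mem_kochStage 0 ξ, rfl⟩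
  | succ n ih =>
    obtain ⟨x, hx, h⟩ := ih fun n => ξ (n + 1)
    refine ⟨x, hx, ?_⟩
    rw [code_eq, ← h]
    rfl

/-- The uniform probability measure on the four indices. -/
def uniformMeasure : Measure (Fin 4) := (PMF.uniformOfFintype (Fin 4)).toMeasure

instance : IsProbabilityMeasure uniformMeasure :=
  inferInstanceAs (IsProbabilityMeasure (PMF.uniformOfFintype (Fin 4)).toMeasure)

lemma uniformMeasure_singleton (i : Fin 4) : uniformMeasure {i} = 4⁻¹ := by
  rw [uniformMeasure, PMF.toMeasure_apply_singleton _ _ (MeasurableSet.singleton i)]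
  simp

/-- The uniform probability measure on the sequences of indices. -/
def codeMeasure : Measure (ℕ → Fin 4) := Measure.infinitePi fun _ => uniformMeasure

instance : IsProbabilityMeasure codeMeasure :=
  inferInstanceAs (IsProbabilityMeasure (Measure.infinitePi fun _ : ℕ => uniformMeasure))

lemma codeMeasure_cylinder {n : ℕ} (w : Fin n → Fin 4) :
    codeMeasure {ξ | (fun i : Fin n => ξ i) = w} = 4⁻¹ ^ n := by
  have h : {ξ : ℕ → Fin 4 | (fun i : Fin n => ξ i) = w} =
      Set.pi (Finset.range n) fun j => if h : j < n then {w ⟨j, h⟩} else Set.univ := by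
    ext ξ
    simp only [Set.mem_ofPred_eq, Set.mem_pi, Finset.coe_range, Set.mem_Iio, funext_iff]
    constructor
    · intro h j hj
      simpa [hj] using h ⟨j, hj⟩
    · intro h j
      simpa using h j j.2
  rw [h, codeMeasure, Measure.infinitePi_pi _ fun _ _ => MeasurableSet.of_discrete]
  rw [Finset.prod_congr rfl (g := fun _ => 4⁻¹)]
  · simp
  · intro j hj
    rw [dif_pos (Finset.mem_range.1 hj), uniformMeasure_singleton]

/-- At most `6400` cells of generation `n` meet such a set, and each cylinder of length `n` has mass
`4⁻¹ ^ n`. -/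
lemma codeMeasure_preimage_le {n : ℕ} {s : Set ℂ}
    (hs : Metric.ediam s ≤ ENNReal.ofReal (1 / 3 ^ n)) :
    codeMeasure (code ⁻¹' s) ≤ ENNReal.ofReal (6400 / 4 ^ n) := by
  classical
  set F : Finset (Fin n → Fin 4) :=
    {w | (cellMap n w '' kochStage 0 ∩ s).Nonempty} with hF
  have hsub : code ⁻¹' s ⊆ ⋃ w ∈ F, {ξ | (fun i : Fin n => ξ i) = w} := by
    intro ξ hξ
    refine Set.mem_iUnion₂.2 ⟨fun i => ξ i, ?_, rfl⟩
    rw [hF, Finset.mem_filter]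
    exact ⟨Finset.mem_univ _, code ξ, code_mem_cell n ξ, hξ⟩
  refine (measure_mono hsub).trans ((measure_biUnion_finset_le _ _).trans ?_)
  simp only [codeMeasure_cylinder, Finset.sum_const, nsmul_eq_mul]
  have hcard : F.card ≤ 6400 := card_le_of_inter_nonempty hs F fun w hw =>
    (Finset.mem_filter.1 hw).2
  have h4 : (4⁻¹ : ENNReal) ^ n = ENNReal.ofReal (1 / 4 ^ n) := by
    rw [ENNReal.ofReal_div_of_pos (by positivity), ENNReal.ofReal_pow (by norm_num)]
    simp [ENNReal.inv_pow]
  rw [h4, ← ENNReal.ofReal_natCast, ← ENNReal.ofReal_mul (by positivity)]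
  refine ENNReal.ofReal_le_ofReal ?_
  rw [mul_one_div]
  have : (F.card : ℝ) ≤ 6400 := by exact_mod_cast hcard
  gcongr

/-- The diameter lies between two consecutive powers of `1 / 3`; replacing it by the larger costs a
factor `3 ^ dimension = 4`, whence `25600 = 4 * 6400`. -/
lemma codeMeasure_preimage_le_ediam_rpow {s : Set ℂ} (hs : Metric.ediam s ≤ 1) :
    codeMeasure (code ⁻¹' s) ≤ 25600 * Metric.ediam s ^ dimension := by
  lift Metric.ediam s to NNReal using (hs.trans_lt ENNReal.one_lt_top).ne with δ hδ
  have hle : ∀ n : ℕ, (δ : ℝ) ≤ 1 / 3 ^ n →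
      codeMeasure (code ⁻¹' s) ≤ ENNReal.ofReal (6400 / 4 ^ n) := by
    intro n hn
    refine codeMeasure_preimage_le ?_
    rw [← hδ, ← ENNReal.ofReal_coe_nnreal]
    exact ENNReal.ofReal_le_ofReal hn
  rcases eq_or_ne δ 0 with h0 | h0
  · refine le_trans (ge_of_tendsto' (tendsto_div_pow_zero (a := 6400) (b := 4) (by norm_num))
      fun n => hle n ?_) zero_le
    rw [h0]; positivity
  · have hpos : (0 : ℝ) < δ := by positivity
    obtain ⟨n, hn1, hn2⟩ := exists_nat_pow_near_of_lt_one (y := (1 / 3 : ℝ)) hpos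
      (by exact_mod_cast hs) (by norm_num) (by norm_num)
    refine (hle n (by simpa using hn2)).trans ?_
    rw [← ENNReal.ofReal_coe_nnreal, ENNReal.ofReal_rpow_of_pos hpos,
      show (25600 : ENNReal) = ENNReal.ofReal 25600 by simp,
      ← ENNReal.ofReal_mul (by norm_num)]
    refine ENNReal.ofReal_le_ofReal ?_
    have h1 := Real.rpow_le_rpow (by positivity) hn1.le dimension_pos.le
    rw [one_div, inv_pow, ← one_div, div_three_pow_rpow_dimension (by norm_num),
      Real.one_rpow, pow_succ] at h1
    calc (6400 : ℝ) / 4 ^ n = 25600 * (1 / (4 ^ n * 4)) := by field_simp; norm_num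
      _ ≤ _ := by gcongr

/-- Mass distribution principle: the image of the uniform measure on codes is a probability measure
carried by the curve, and small sets have mass at most a constant times their diameter to the power
`dimension`. -/
lemma hausdorffMeasure_kochCurve_pos : 0 < Measure.hausdorffMeasure dimension kochCurve := by
  have hle : (25600⁻¹ : ENNReal) • codeMeasure.map code ≤ Measure.hausdorffMeasure dimension := by
    refine Measure.le_hausdorffMeasure dimension _ 1 one_pos fun s hs => ?_
    -- Passing to the closure keeps the diameter and makes the set measurable.
    rw [← Metric.ediam_closure] at hs ⊢
    refine (measure_mono subset_closure).trans ?_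
    rw [Measure.smul_apply, Measure.map_apply continuous_code.measurable
      isClosed_closure.measurableSet, smul_eq_mul]
    calc (25600⁻¹ : ENNReal) * codeMeasure (code ⁻¹' closure s)
        ≤ 25600⁻¹ * (25600 * Metric.ediam (closure s) ^ dimension) := by
          gcongr; exact codeMeasure_preimage_le_ediam_rpow hs
      _ = _ := by
          rw [← mul_assoc, ENNReal.inv_mul_cancel (by norm_num) (by norm_num), one_mul]
  refine lt_of_lt_of_le ?_ (hle kochCurve)
  rw [Measure.smul_apply, Measure.map_apply continuous_code.measurable
    isCompact_kochCurve.isClosed.measurableSet,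
    Set.eq_univ_of_forall (s := code ⁻¹' kochCurve) code_mem_kochCurve, measure_univ, smul_eq_mul,
    mul_one]
  simp

/-! ### The boundary measure -/

lemma hausdorffMeasure_side (i : Fin 3) : Measure.hausdorffMeasure dimension (side i) =
    Measure.hausdorffMeasure dimension kochCurve :=
  (isometry_sideMap i).hausdorffMeasure_image (Or.inl dimension_pos.le) _

lemma boundaryMeasure_univ : boundaryMeasure Set.univ = 3 := by
  have h : ∀ i : Fin 3, (Measure.hausdorffMeasure dimension (side i))⁻¹ *
      Measure.hausdorffMeasure dimension (side i) = 1 := fun i => by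
    rw [hausdorffMeasure_side]
    exact ENNReal.inv_mul_cancel hausdorffMeasure_kochCurve_pos.ne'
      hausdorffMeasure_kochCurve_lt_top.ne
  simp [boundaryMeasure, h]

instance : IsFiniteMeasure boundaryMeasure :=
  ⟨by rw [boundaryMeasure_univ]; exact ENNReal.ofNat_lt_top⟩

lemma ae_mem_curve : ∀ᵐ x ∂boundaryMeasure, x ∈ curve := by
  rw [ae_iff, boundaryMeasure, Measure.finsetSum_apply, Finset.sum_eq_zero]
  intro i _
  have h : {x | x ∉ curve} ∩ side i = ∅ := by
    rw [← Set.disjoint_iff_inter_eq_empty, Set.disjoint_left]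
    exact fun x hx hi => hx (Set.mem_iUnion.2 ⟨i, hi⟩)
  rw [Measure.smul_apply, Measure.restrict_apply' (isCompact_side i).isClosed.measurableSet, h,
    measure_empty, smul_zero]

/-! ### The snowflake domain and its measure density -/

lemma isOpen_domain : IsOpen domain := by
  have hopen : IsOpen curveᶜ := isCompact_curve.isClosed.isOpen_compl
  rw [isOpen_iff_mem_nhds]
  rintro z ⟨hz, hb⟩
  filter_upwards [hopen.connectedComponentIn.mem_nhds (mem_connectedComponentIn hz)] with w hw
  exact ⟨connectedComponentIn_subset _ _ hw, connectedComponentIn_eq hw ▸ hb⟩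

/-- From a point outside a disc about the origin containing the curve, the radial ray to infinity
avoids the curve, so the component of that point is unbounded. -/
lemma isBounded_domain : Bornology.IsBounded domain := by
  obtain ⟨R, hR, hsub⟩ := isCompact_curve.isBounded.subset_closedBall_lt 0 0
  refine Metric.isBounded_closedBall.subset (fun z hz => ?_) (t := Metric.closedBall 0 R)
  by_contra hzR
  rw [mem_closedBall_zero_iff, not_le] at hzR
  have hpre : IsPreconnected ((fun t : ℝ => (t : ℂ) * z) '' Set.Ici 1) :=
    isPreconnected_Ici.image _ (by fun_prop)
  have hdisj : (fun t : ℝ => (t : ℂ) * z) '' Set.Ici 1 ⊆ curveᶜ := by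
    rintro _ ⟨t, ht, rfl⟩ hmem
    have h1 := mem_closedBall_zero_iff.1 (hsub hmem)
    rw [norm_mul, Complex.norm_real, Real.norm_of_nonneg (zero_le_one.trans ht)] at h1
    have h2 : 1 * ‖z‖ ≤ t * ‖z‖ := mul_le_mul_of_nonneg_right ht (norm_nonneg _)
    linarith
  have hb := hz.2.subset (hpre.subset_connectedComponentIn ⟨1, Set.self_mem_Ici, by simp⟩ hdisj)
  obtain ⟨C, hC⟩ := hb.exists_norm_le
  have hz0 : 0 < ‖z‖ := hR.trans hzR
  have h1 : (1 : ℝ) ≤ max 1 ((C + 1) / ‖z‖) := le_max_left _ _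
  have h2 := hC _ ⟨max 1 ((C + 1) / ‖z‖), h1, rfl⟩
  simp only at h2
  rw [norm_mul, Complex.norm_real, Real.norm_of_nonneg (zero_le_one.trans h1)] at h2
  have h3 : (C + 1) / ‖z‖ * ‖z‖ ≤ max 1 ((C + 1) / ‖z‖) * ‖z‖ := by
    gcongr; exact le_max_right _ _
  rw [div_mul_cancel₀ _ hz0.ne'] at h3
  linarith

lemma isBounded_polygonUnion : Bornology.IsBounded polygonUnion := by
  have h1 : Bornology.IsBounded baseTriangle := by
    refine Metric.isBounded_closedBall.subset (fun z hz => ?_) (t := Metric.closedBall 0 4)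
    obtain ⟨h1, h2, h3⟩ := hz
    rw [mem_closedBall_zero_iff]
    have h4 := Complex.norm_le_abs_re_add_abs_im z
    have h5 := abs_im_le_abs_height z
    have h6 : |z.re| ≤ 1 := by rw [abs_le]; constructor <;> linarith
    have h7 : |height z| ≤ 3 := by rw [abs_le]; constructor <;> linarith
    linarith
  have h2 : IsCompact (stage 0) :=
    isCompact_iUnion fun i => (isCompact_kochStage 0).image (continuous_sideMap i)
  refine (h1.union h2.isBounded).subset (Set.iUnion_subset fun n => Set.union_subset_union_right _
    (Set.iUnion_mono fun _ => Set.image_mono (cap_subset_kochStage_zero n)))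

/-- A component of the complement of the curve cannot cross the frontier of the bounded set
`polygonUnion`; once it meets the interior it stays there and is bounded. -/
lemma polygonUnion_diff_subset : polygonUnion \ curve ⊆ domain := by
  rintro z ⟨hz, hzc⟩
  have hint : ∀ w ∈ closure polygonUnion, w ∉ curve → w ∈ interior polygonUnion := by
    intro w hw hwc
    by_contra h
    exact hwc (frontier_polygonUnion_subset ⟨hw, h⟩)
  refine ⟨hzc, isBounded_polygonUnion.subset (subset_trans ?_ interior_subset)⟩
  refine isPreconnected_connectedComponentIn.subset_of_closure_inter_subset isOpen_interior
    ⟨z, mem_connectedComponentIn hzc, hint z (subset_closure hz) hzc⟩ ?_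
  rintro w ⟨hw, hwc⟩
  exact hint w (closure_mono interior_subset hw) (connectedComponentIn_subset _ _ hwc)

lemma exists_ball_subset_polygonUnion {x : ℂ} (hx : x ∈ curve) (n : ℕ) :
    ∃ y, ‖x - y‖ ≤ 2 / 3 ^ n ∧ Metric.ball y (1 / 20 / 3 ^ n) ⊆ polygonUnion := by
  obtain ⟨i, z, hz, rfl⟩ := Set.mem_iUnion.1 hx
  obtain ⟨y, hy1, hy2⟩ := exists_ball_subset_cap (Set.mem_iInter.1 hz n)
  refine ⟨sideMap i y, by rwa [norm_sideMap_sub], ?_⟩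
  rw [← sideMap_image_ball]
  exact ((Set.image_mono hy2).trans (sideMap_image_cap_subset i _)).trans
    (Set.subset_iUnion polygon _)

lemma ball_subset_domain {x : ℂ} {r : ℝ} (hx : x ∈ domain)
    (h : Disjoint (Metric.ball x r) curve) : Metric.ball x r ⊆ domain := by
  intro y hy
  have hr : 0 < r := Metric.pos_of_mem_ball hy
  have hsub : Metric.ball x r ⊆ connectedComponentIn curveᶜ x :=
    (convex_ball x r).isPreconnected.subset_connectedComponentIn (Metric.mem_ball_self hr)
      h.subset_compl_right
  exact ⟨h.subset_compl_right hy, connectedComponentIn_eq (hsub hy) ▸ hx.2⟩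

lemma ofReal_sq_le_volume_ball (x : ℂ) {r : ℝ} (hr : 0 ≤ r) :
    ENNReal.ofReal (r ^ 2) ≤ volume (Metric.ball x r) := by
  rw [Complex.volume_ball, ← ENNReal.ofReal_pow hr, ← ENNReal.ofReal_coe_nnreal,
    ← ENNReal.ofReal_mul (by positivity)]
  refine ENNReal.ofReal_le_ofReal (le_mul_of_one_le_right (by positivity) ?_)
  rw [NNReal.coe_real_pi]
  linarith [Real.pi_gt_three]

lemma volume_ball_inter_domain_of_mem_curve {R : ℝ} (hR : 3 ≤ R) {x : ℂ} (hx : x ∈ curve) {r : ℝ}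
    (hr : 0 < r) (hrR : r ≤ R) :
    ENNReal.ofReal ((r / (60 * R)) ^ 2) ≤ volume (Metric.ball x r ∩ domain) := by
  have hR0 : 0 < R := by linarith
  -- With `n` chosen so that `1 / 3 ^ (n + 1) < r / R ≤ 1 / 3 ^ n`, the interior ball of generation
  -- `n + 1` fits into `ball x r` because `R ≥ 3`, and its radius `1 / (60 * 3 ^ n)` is at least `r
  -- / (60 * R)`.
  obtain ⟨n, hn1, hn2⟩ := exists_nat_pow_near_of_lt_one (y := (1 / 3 : ℝ)) (div_pos hr hR0)
    ((div_le_one hR0).2 hrR) (by norm_num) (by norm_num)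
  obtain ⟨y, hy1, hy2⟩ := exists_ball_subset_polygonUnion hx (n + 1)
  have h3 : 3 / 3 ^ (n + 1) < r := by
    rw [one_div, inv_pow, inv_eq_one_div, lt_div_iff₀ hR0] at hn1
    refine lt_of_le_of_lt ?_ hn1
    rw [one_div_mul_eq_div]
    gcongr
  have hsub : Metric.ball y (1 / 20 / 3 ^ (n + 1)) \ curve ⊆ Metric.ball x r ∩ domain := by
    rintro z ⟨hz, hzc⟩
    refine ⟨?_, polygonUnion_diff_subset ⟨hy2 hz, hzc⟩⟩
    rw [Metric.mem_ball] at hz ⊢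
    rw [← dist_eq_norm, dist_comm] at hy1
    have h4 := dist_triangle z y x
    have h5 : (1 : ℝ) / 20 / 3 ^ (n + 1) < 1 / 3 ^ (n + 1) := by gcongr; norm_num
    calc dist z x < 1 / 3 ^ (n + 1) + 2 / 3 ^ (n + 1) := by linarith
      _ = 3 / 3 ^ (n + 1) := by ring
      _ < r := h3
  refine le_trans ?_ (measure_mono hsub)
  rw [measure_sdiff_null volume_curve]
  refine le_trans (ENNReal.ofReal_le_ofReal ?_) (ofReal_sq_le_volume_ball _ (by positivity))
  refine pow_le_pow_left₀ (by positivity) ?_ 2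
  rw [one_div, inv_pow, inv_eq_one_div] at hn2
  calc r / (60 * R) = r / R / 60 := by rw [div_div, mul_comm]
    _ ≤ 1 / 3 ^ n / 60 := by gcongr
    _ = 1 / 20 / 3 ^ (n + 1) := by rw [pow_succ]; field_simp; norm_num

/-- The snowflake domain satisfies the measure density condition, up to its boundary. -/
lemma exists_measure_density : ∃ R c : ℝ, 0 < R ∧ 0 < c ∧
    (∀ x ∈ curve ∪ domain, domain ⊆ Metric.ball x R) ∧
    ∀ x ∈ curve ∪ domain, ∀ r, 0 < r → r ≤ R →
      ENNReal.ofReal (c * r ^ 2) ≤ volume (Metric.ball x r ∩ domain) := by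
  obtain ⟨ρ, hρ, hsub⟩ :=
    (isCompact_curve.isBounded.union isBounded_domain).subset_closedBall_lt 0 0
  have hR : 3 ≤ 2 * ρ + 3 := by linarith
  refine ⟨2 * ρ + 3, (1 / (120 * (2 * ρ + 3))) ^ 2, by linarith, by positivity, ?_, ?_⟩
  · intro x hx y hy
    have h1 := hsub hx
    have h2 := hsub (Or.inr hy)
    rw [Metric.mem_closedBall] at h1 h2
    rw [Metric.mem_ball]
    have := dist_triangle_right y x 0
    linarith
  · intro x hx r hr hrR
    rw [← mul_pow, one_div_mul_eq_div]
    have key : ∀ y ∈ curve, dist x y < r / 2 →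
        ENNReal.ofReal ((r / (120 * (2 * ρ + 3))) ^ 2) ≤ volume (Metric.ball x r ∩ domain) := by
      intro y hy hxy
      have h := volume_ball_inter_domain_of_mem_curve hR hy (half_pos hr) (by linarith)
      rw [show r / 2 / (60 * (2 * ρ + 3)) = r / (120 * (2 * ρ + 3)) by rw [div_div]; ring_nf] at h
      refine h.trans (measure_mono (Set.inter_subset_inter_left _ ?_))
      refine Metric.ball_subset_ball' ?_
      rw [dist_comm] at hxy
      linarith
    -- Either the half ball misses the curve and lies wholly in the domain, or the boundary estimate
    -- applies at a nearby curve point with radius `r / 2`; the halving turns `60` into `120`.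
    by_cases hd : Disjoint (Metric.ball x (r / 2)) curve
    · rcases hx with hx | hx
      · exact absurd hx (Set.disjoint_left.1 hd (Metric.mem_ball_self (half_pos hr)))
      · refine le_trans (ENNReal.ofReal_le_ofReal ?_) ((ofReal_sq_le_volume_ball x
          (half_pos hr).le).trans (measure_mono (Set.subset_inter
            (Metric.ball_subset_ball (half_le_self hr.le)) (ball_subset_domain hx hd))))
        gcongr
        linarith
    · obtain ⟨y, hy, hyc⟩ := Set.not_disjoint_iff.1 hd
      exact key y hyc (by rwa [dist_comm])

lemma curve_subset_closure_domain : curve ⊆ closure domain := by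
  obtain ⟨R, c, hR, hc, -, h⟩ := exists_measure_density
  intro x hx
  rw [Metric.mem_closure_iff]
  intro ε hε
  have h1 := h x (Or.inl hx) (min ε R) (lt_min hε hR) (min_le_right _ _)
  have h2 : volume (Metric.ball x (min ε R) ∩ domain) ≠ 0 :=
    (lt_of_lt_of_le (ENNReal.ofReal_pos.2 (by have := lt_min hε hR; positivity)) h1).ne'
  obtain ⟨y, hy, hyd⟩ := nonempty_of_measure_ne_zero h2
  exact ⟨y, hyd, by rw [dist_comm]; exact (Metric.mem_ball.1 hy).trans_le (min_le_left _ _)⟩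

lemma isCompact_closure_domain : IsCompact (closure domain) := isBounded_domain.isCompact_closure

end Snowflake

namespace FracSobolev

/-! ### Clarkson, Jensen and Morrey inequalities -/

/-- Clarkson's inequality for real numbers. -/
lemma abs_half_add_rpow_add_abs_half_sub_rpow_le {p : ℝ} (hp : 2 ≤ p) (a b : ℝ) :
    |(a + b) / 2| ^ p + |(a - b) / 2| ^ p ≤ (|a| ^ p + |b| ^ p) / 2 := by
  have hsq : ∀ t : ℝ, |t| ^ p = (t ^ 2) ^ (p / 2) := fun t => by
    rw [← sq_abs, ← Real.rpow_natCast, ← Real.rpow_mul (abs_nonneg t)]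
    congr 1
    push_cast
    ring
  have hp' : 1 ≤ p / 2 := by linarith
  simp only [hsq]
  -- The power `p / 2 ≥ 1` is superadditive and convex on `[0, ∞)`; between the two uses, the
  -- parallelogram identity evaluates the sum of squares.
  refine (Real.add_rpow_le_rpow_add (sq_nonneg _) (sq_nonneg _) hp').trans ?_
  have hconv := convexOn_rpow hp'
  have h := hconv.2 (Set.mem_Ici.2 (sq_nonneg a)) (Set.mem_Ici.2 (sq_nonneg b))
    (show (0 : ℝ) ≤ 1 / 2 by norm_num) (show (0 : ℝ) ≤ 1 / 2 by norm_num) (by norm_num)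
  simp only [smul_eq_mul] at h
  calc _ = (1 / 2 * a ^ 2 + 1 / 2 * b ^ 2) ^ (p / 2) := by congr 1; ring
    _ ≤ _ := h
    _ = _ := by ring

/-- Jensen's inequality for the power `p ≥ 1`. -/
lemma enorm_integral_rpow_le {α : Type*} [MeasurableSpace α] {ν : Measure α}
    [IsProbabilityMeasure ν] {p : ℝ} (hp : 1 ≤ p) {F : α → ℝ} (hF : AEStronglyMeasurable F ν) :
    ‖∫ x, F x ∂ν‖ₑ ^ p ≤ ∫⁻ x, ‖F x‖ₑ ^ p ∂ν := by
  have hp0 : 0 < p := by linarith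
  have h1 := eLpNorm_le_eLpNorm_of_exponent_le (p := 1) (q := ENNReal.ofReal p)
    (by simpa using hp) hF
  rw [eLpNorm_one_eq_lintegral_enorm, eLpNorm_eq_lintegral_rpow_enorm_toReal
    (by simpa using hp0) ENNReal.ofReal_ne_top, ENNReal.toReal_ofReal hp0.le] at h1
  have h2 := ENNReal.rpow_le_rpow ((enorm_integral_le_lintegral_enorm F).trans h1) hp0.le
  rwa [← ENNReal.rpow_mul, one_div_mul_cancel hp0.ne', ENNReal.rpow_one] at h2

/-- The difference of the averages is the mean of `u z.1 - u z.2` for the product of the two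
normalized measures, to which Jensen's inequality applies. -/
lemma enorm_setAverage_sub_rpow_le {α : Type*} [MeasurableSpace α] {μ : Measure α} [SFinite μ]
    {p : ℝ} (hp : 1 ≤ p) {A B : Set α} (hA : μ A ≠ 0) (hB : μ B ≠ 0) (hA' : μ A ≠ ⊤)
    (hB' : μ B ≠ ⊤) {u : α → ℝ} (huA : IntegrableOn u A μ) (huB : IntegrableOn u B μ) :
    ‖(⨍ y in A, u y ∂μ) - ⨍ y in B, u y ∂μ‖ₑ ^ p ≤ (μ A)⁻¹ * (μ B)⁻¹ *
      ∫⁻ z, ‖u z.1 - u z.2‖ₑ ^ p ∂((μ.restrict A).prod (μ.restrict B)) := by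
  have hprob : ∀ S : Set α, μ S ≠ 0 → μ S ≠ ⊤ →
      IsProbabilityMeasure ((μ S)⁻¹ • μ.restrict S) := fun S h0 h1 =>
    ⟨by simp [ENNReal.inv_mul_cancel h0 h1]⟩
  have := hprob A hA hA'
  have := hprob B hB hB'
  have hu1 : Integrable u ((μ A)⁻¹ • μ.restrict A) := huA.smul_measure (by simpa using hA)
  have hu2 : Integrable u ((μ B)⁻¹ • μ.restrict B) := huB.smul_measure (by simpa using hB)
  have hint1 := hu1.comp_fst ((μ B)⁻¹ • μ.restrict B)
  have hint2 := hu2.comp_snd ((μ A)⁻¹ • μ.restrict A)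
  have key := enorm_integral_rpow_le hp (hint1.sub hint2).aestronglyMeasurable
  simp only [Pi.sub_apply] at key
  rw [integral_sub hint1 hint2, integral_fun_fst, integral_fun_snd, probReal_univ, probReal_univ,
    one_smul, one_smul, ← setAverage_eq', ← setAverage_eq'] at key
  refine key.trans_eq ?_
  rw [Measure.prod_smul_left, Measure.prod_smul_right, lintegral_smul_measure,
    lintegral_smul_measure, smul_eq_mul, smul_eq_mul, mul_assoc]

/-- Two points of a ball of radius `r` are at distance at most `2 * r`, which bounds the singular
weight from below; on the diagonal both integrands vanish. -/
lemma lintegral_prod_le_gagliardo {s p : ℝ} (hp : 0 < p) (hsp : 0 ≤ 2 + s * p) {G A B : Set ℂ}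
    {x : ℂ} {r : ℝ} (hA : A ⊆ Metric.ball x r ∩ G) (hB : B ⊆ Metric.ball x r ∩ G)
    (hAm : MeasurableSet A) (hBm : MeasurableSet B) (u : ℂ → ℝ) :
    ∫⁻ z, ‖u z.1 - u z.2‖ₑ ^ p ∂(((volume : Measure ℂ).restrict A).prod (volume.restrict B)) ≤
      ENNReal.ofReal ((2 * r) ^ (2 + s * p)) * gagliardo s p G u := by
  calc ∫⁻ z, ‖u z.1 - u z.2‖ₑ ^ p ∂(((volume : Measure ℂ).restrict A).prod (volume.restrict B))
      ≤ ∫⁻ z, ENNReal.ofReal ((2 * r) ^ (2 + s * p)) *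
          ENNReal.ofReal (|u z.1 - u z.2| ^ p / ‖z.1 - z.2‖ ^ (2 + s * p))
          ∂(((volume : Measure ℂ).restrict A).prod (volume.restrict B)) := by
        rw [Measure.prod_restrict]
        refine setLIntegral_mono' (hAm.prod hBm) fun z hz => ?_
        have h1 := (hA hz.1).1
        have h2 := (hB hz.2).1
        have hr : 0 < r := Metric.pos_of_mem_ball h1
        have h3 : ‖z.1 - z.2‖ ≤ 2 * r := by
          rw [← dist_eq_norm]
          rw [Metric.mem_ball] at h1 h2
          have := dist_triangle_right z.1 z.2 x
          linarith
        rw [← ENNReal.ofReal_mul (by positivity), Real.enorm_eq_ofReal_abs,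
          ENNReal.ofReal_rpow_of_nonneg (abs_nonneg _) hp.le]
        refine ENNReal.ofReal_le_ofReal ?_
        rcases eq_or_ne z.1 z.2 with h | h
        · rw [h]
          simp [Real.zero_rpow hp.ne']
        · have h4 : 0 < ‖z.1 - z.2‖ := norm_pos_iff.2 (sub_ne_zero.2 h)
          rw [mul_div_assoc', le_div_iff₀ (by positivity), mul_comm]
          gcongr
    _ = ENNReal.ofReal ((2 * r) ^ (2 + s * p)) *
          ∫⁻ z, ENNReal.ofReal (|u z.1 - u z.2| ^ p / ‖z.1 - z.2‖ ^ (2 + s * p))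
          ∂(((volume : Measure ℂ).restrict A).prod (volume.restrict B)) :=
        lintegral_const_mul' _ _ ENNReal.ofReal_ne_top
    _ ≤ _ := by
        gcongr
        exact lintegral_mono' (Measure.prod_mono
          (Measure.restrict_mono (hA.trans Set.inter_subset_right) le_rfl)
          (Measure.restrict_mono (hB.trans Set.inter_subset_right) le_rfl)) le_rfl

/-- Comparison of the averages of `u` over balls with comparable radii. -/
lemma abs_average_sub_average_le {s p c R : ℝ} (hp : 1 ≤ p) (hsp : 2 < s * p) (hc : 0 < c)
    {G : Set ℂ} (hG : MeasurableSet G) {u : ℂ → ℝ} (hu : IntegrableOn u G)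
    (hgu : gagliardo s p G u < ⊤) {x : ℂ}
    (hx : ∀ r, 0 < r → r ≤ R → ENNReal.ofReal (c * r ^ 2) ≤ volume (Metric.ball x r ∩ G))
    {r r' : ℝ} (hr' : 0 < r') (h1 : r / 2 ≤ r') (h2 : r' ≤ r) (h3 : r ≤ R) :
    |(⨍ y in Metric.ball x r ∩ G, u y) - ⨍ y in Metric.ball x r' ∩ G, u y| ≤
      (16 * 2 ^ (2 + s * p) / c ^ 2) ^ (1 / p) * (gagliardo s p G u).toReal ^ (1 / p) *
        r ^ ((s * p - 2) / p) := by
  have hr : 0 < r := hr'.trans_le h2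
  have hp0 : 0 < p := by linarith
  set N := gagliardo s p G u with hN
  have hfin : ∀ ρ, volume (Metric.ball x ρ ∩ G) ≠ ⊤ := fun ρ =>
    ((measure_mono Set.inter_subset_left).trans_lt measure_ball_lt_top).ne
  have hlow : ∀ ρ, r / 2 ≤ ρ → ρ ≤ R →
      ENNReal.ofReal (c * (r / 2) ^ 2) ≤ volume (Metric.ball x ρ ∩ G) := fun ρ hρ1 hρ2 =>
    (ENNReal.ofReal_le_ofReal (by gcongr)).trans (hx ρ (by linarith) hρ2)
  have hpos : 0 < ENNReal.ofReal (c * (r / 2) ^ 2) := ENNReal.ofReal_pos.2 (by positivity)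
  have hr1 := hlow r (by linarith) h3
  have hr2 := hlow r' h1 (h2.trans h3)
  have hm : ∀ ρ, MeasurableSet (Metric.ball x ρ ∩ G) := fun ρ => measurableSet_ball.inter hG
  have key := enorm_setAverage_sub_rpow_le hp (hpos.trans_le hr1).ne' (hpos.trans_le hr2).ne'
    (hfin r) (hfin r') (hu.mono_set Set.inter_subset_right) (hu.mono_set Set.inter_subset_right)
  have key2 := key.trans (mul_le_mul' (mul_le_mul' (ENNReal.inv_le_inv.2 hr1)
    (ENNReal.inv_le_inv.2 hr2)) (lintegral_prod_le_gagliardo (s := s) hp0 (by linarith) subset_rfl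
      (Set.inter_subset_inter_left _ (Metric.ball_subset_ball h2)) (hm r) (hm r') u))
  rw [← hN, ← ENNReal.ofReal_toReal hgu.ne, ← ENNReal.ofReal_inv_of_pos (by positivity),
    ← ENNReal.ofReal_mul (by positivity), ← ENNReal.ofReal_mul (by positivity),
    ← ENNReal.ofReal_mul (by positivity), Real.enorm_eq_ofReal_abs,
    ENNReal.ofReal_rpow_of_nonneg (abs_nonneg _) hp0.le,
    ENNReal.ofReal_le_ofReal_iff (by positivity)] at key2
  rw [← Real.rpow_le_rpow_iff (abs_nonneg _) (by positivity) hp0]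
  refine key2.trans_eq ?_
  have hroot : ∀ X Y : ℝ, 0 ≤ X → 0 ≤ Y → (X ^ (1 / p) * Y ^ (1 / p) * r ^ ((s * p - 2) / p)) ^ p =
      X * Y * r ^ (s * p - 2) := fun X Y hX hY => by
    rw [Real.mul_rpow (by positivity) (by positivity), Real.mul_rpow (by positivity) (by positivity),
      ← Real.rpow_mul hX, ← Real.rpow_mul hY, ← Real.rpow_mul hr.le,
      one_div_mul_cancel hp0.ne', Real.rpow_one, Real.rpow_one, div_mul_cancel₀ _ hp0.ne']
  rw [hroot _ _ (by positivity) ENNReal.toReal_nonneg, Real.mul_rpow (by norm_num) hr.le]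
  -- The kernel contributes `r ^ (2 + s * p)` and the two volumes `r ^ (-4)`; what remains is `r ^
  -- (s * p - 2)`, a positive power.
  have hexp : r ^ (2 + s * p) = r ^ (s * p - 2) * r ^ 4 := by
    rw [show 2 + s * p = (s * p - 2) + (4 : ℕ) by push_cast; ring, Real.rpow_add_natCast hr.ne']
  rw [hexp]
  field_simp
  ring

/-- Telescoping over dyadic radii. -/
lemma abs_sub_le_of_dyadic {m : ℝ → ℝ} {B α R : ℝ} (hα : 0 < α) (hB : 0 ≤ B)
    (h : ∀ r r', 0 < r' → r / 2 ≤ r' → r' ≤ r → r ≤ R → |m r - m r'| ≤ B * r ^ α)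
    {r r' : ℝ} (hr' : 0 < r') (hr : r' ≤ r) (hrR : r ≤ R) :
    |m r - m r'| ≤ B / (1 - 2⁻¹ ^ α) * r ^ α := by
  have hq : (2⁻¹ : ℝ) ^ α < 1 := Real.rpow_lt_one (by norm_num) (by norm_num) hα
  have hq' : (0 : ℝ) < 1 - 2⁻¹ ^ α := by linarith
  -- Induction on the number of halvings from `r` to `r'`. With `q = 2⁻¹ ^ α`, the constant `K = B /
  -- (1 - q)` is the fixed point of `K = B + K * q`, the sum of the geometric series.
  have key : ∀ (k : ℕ) (r : ℝ), r / 2 ^ k ≤ r' → r' ≤ r → r ≤ R →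
      |m r - m r'| ≤ B / (1 - 2⁻¹ ^ α) * r ^ α := by
    intro k
    induction k with
    | zero =>
      intro r h1 h2 h3
      have hr0 : 0 < r := hr'.trans_le h2
      have : r = r' := le_antisymm (by simpa using h1) h2
      rw [this, sub_self, abs_zero]
      positivity
    | succ k ih =>
      intro r h1 h2 h3
      have hr0 : 0 < r := hr'.trans_le h2
      have hrα : 0 ≤ r ^ α := by positivity
      rcases le_or_gt (r / 2) r' with h4 | h4
      · refine (h r r' hr' h4 h2 h3).trans ?_
        gcongr
        rw [le_div_iff₀ hq']
        nlinarith [Real.rpow_nonneg (show (0 : ℝ) ≤ 2⁻¹ by norm_num) α]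
      · have h5 := h r (r / 2) (by linarith) le_rfl (by linarith) h3
        have h6 := ih (r / 2) (by rwa [div_div, ← pow_succ']) h4.le (by linarith)
        rw [div_eq_mul_inv r 2, Real.mul_rpow hr0.le (by norm_num)] at h6
        calc |m r - m r'| ≤ |m r - m (r / 2)| + |m (r / 2) - m r'| := abs_sub_le _ _ _
          _ ≤ B * r ^ α + B / (1 - 2⁻¹ ^ α) * (r ^ α * 2⁻¹ ^ α) := by
              rw [div_eq_mul_inv r 2] at *; exact add_le_add h5 h6
          _ = _ := by
              generalize (2⁻¹ : ℝ) ^ α = q at hq'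
              field_simp
              ring
  obtain ⟨k, hk⟩ := pow_unbounded_of_one_lt (r / r') (one_lt_two (α := ℝ))
  refine key k r ?_ hr hrR
  rw [div_lt_iff₀ hr'] at hk
  rw [div_le_iff₀ (by positivity), mul_comm]
  exact hk.le

lemma exists_tendsto_of_dyadic {m : ℝ → ℝ} {B α R : ℝ} (hα : 0 < α) (hB : 0 ≤ B) (hR : 0 < R)
    (h : ∀ r r', 0 < r' → r / 2 ≤ r' → r' ≤ r → r ≤ R → |m r - m r'| ≤ B * r ^ α) :
    ∃ l, Tendsto m (𝓝[>] 0) (𝓝 l) ∧ |l - m R| ≤ B / (1 - 2⁻¹ ^ α) * R ^ α := by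
  set K := B / (1 - 2⁻¹ ^ α) with hK
  have hdy := fun r r' (h1 : 0 < r') (h2 : r' ≤ r) (h3 : r ≤ R) =>
    abs_sub_le_of_dyadic hα hB h h1 h2 h3
  rw [← hK] at hdy
  have hcau : Cauchy (map m (𝓝[>] 0)) := by
    rw [Metric.cauchy_iff]
    refine ⟨inferInstance, fun ε hε => ?_⟩
    have hlim : Tendsto (fun r : ℝ => K * r ^ α) (𝓝[>] 0) (𝓝 0) := by
      have : Tendsto (fun r : ℝ => K * r ^ α) (𝓝 0) (𝓝 (K * 0 ^ α)) :=
        ((Real.continuousAt_rpow_const 0 α (Or.inr hα.le)).tendsto).const_mul K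
      rw [Real.zero_rpow hα.ne', mul_zero] at this
      exact this.mono_left nhdsWithin_le_nhds
    obtain ⟨ρ, hρε, hρ0, hρR⟩ := ((hlim.eventually (gt_mem_nhds (half_pos hε))).and
      (Ioc_mem_nhdsGT hR)).exists
    refine ⟨m '' Set.Ioc 0 ρ, image_mem_map (Ioc_mem_nhdsGT hρ0), ?_⟩
    rintro _ ⟨r, hr, rfl⟩ _ ⟨r', hr', rfl⟩
    have h1 := hdy ρ r hr.1 hr.2 hρR
    have h2 := hdy ρ r' hr'.1 hr'.2 hρR
    rw [Real.dist_eq]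
    have h3 := abs_sub_le (m r) (m ρ) (m r')
    rw [abs_sub_comm (m r) (m ρ)] at h3
    linarith
  obtain ⟨l, hl⟩ := cauchy_map_iff_exists_tendsto.1 hcau
  refine ⟨l, hl, ?_⟩
  have h1 : Tendsto (fun r => |m R - m r|) (𝓝[>] 0) (𝓝 |m R - l|) := (hl.const_sub _).abs
  rw [abs_sub_comm]
  refine le_of_tendsto h1 ?_
  filter_upwards [Ioc_mem_nhdsGT hR] with r hr
  exact hdy R r hr.1 hr.2 le_rfl

/-- Morrey's inequality: at a point of measure density the trace exists, and it differs from the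
mean value by at most a multiple of the seminorm. -/
lemma tendsto_trace_and_abs_trace_sub_average_le {s p c R : ℝ} (hp : 1 ≤ p) (hsp : 2 < s * p)
    (hc : 0 < c) (hR : 0 < R) {G : Set ℂ} (hG : MeasurableSet G) {u : ℂ → ℝ}
    (hu : IntegrableOn u G) (hgu : gagliardo s p G u < ⊤) {x : ℂ} (hGx : G ⊆ Metric.ball x R)
    (hx : ∀ r, 0 < r → r ≤ R → ENNReal.ofReal (c * r ^ 2) ≤ volume (Metric.ball x r ∩ G)) :
    Tendsto (fun r : ℝ => ⨍ y in Metric.ball x r ∩ G, u y) (𝓝[>] 0) (𝓝 (trace G u x)) ∧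
      |trace G u x - ⨍ y in G, u y| ≤
        (16 * 2 ^ (2 + s * p) / c ^ 2) ^ (1 / p) / (1 - 2⁻¹ ^ ((s * p - 2) / p)) *
          R ^ ((s * p - 2) / p) * (gagliardo s p G u).toReal ^ (1 / p) := by
  obtain ⟨l, hl, hl'⟩ := exists_tendsto_of_dyadic
    (m := fun r => ⨍ y in Metric.ball x r ∩ G, u y) (div_pos (by linarith) (by linarith))
    (by positivity) hR
    fun r r' h1 h2 h3 h4 => abs_average_sub_average_le hp hsp hc hG hu hgu hx h1 h2 h3 h4
  have htr : trace G u x = l := hl.limUnder_eq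
  rw [htr]
  refine ⟨hl, ?_⟩
  -- At the radius `R` the ball contains `G`, so the last average is the mean over `G`.
  simp only [Set.inter_eq_right.2 hGx] at hl'
  refine hl'.trans_eq ?_
  ring

/-- Lebesgue's differentiation theorem for the trace. -/
lemma ae_trace_eq {G : Set ℂ} {u : ℂ → ℝ} (hu : IntegrableOn u G) :
    ∀ᵐ x ∂((volume : Measure ℂ).restrict G), trace G u x = u x := by
  filter_upwards [(Besicovitch.vitaliFamily ((volume : Measure ℂ).restrict G)).ae_tendsto_average
    (Integrable.locallyIntegrable hu)] with x hx
  refine Tendsto.limUnder_eq ?_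
  refine (hx.comp (Besicovitch.tendsto_filterAt _ x)).congr fun r => ?_
  rw [Function.comp_apply, Measure.restrict_restrict measurableSet_closedBall]
  refine setAverage_congr ?_
  -- The differentiation theorem uses closed balls and the trace open ones; spheres are null.
  refine EventuallyEq.inter ?_ EventuallyEq.rfl
  refine (ae_eq_of_subset_of_measure_ge Metric.ball_subset_closedBall ?_
    measurableSet_ball.nullMeasurableSet measure_closedBall_lt_top.ne).symm
  rw [Measure.addHaar_closedBall_eq_addHaar_ball]

/-! ### Convexity, lower semicontinuity and measurability -/

lemma lintegral_ofReal_clarkson {α : Type*} [MeasurableSpace α] {ν : Measure α}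
    {F₁ F₂ F₃ F₄ : α → ℝ} (h₁ : AEMeasurable F₁ ν) (h₃ : AEMeasurable F₃ ν) (hF₁ : ∀ x, 0 ≤ F₁ x)
    (hF₂ : ∀ x, 0 ≤ F₂ x) (hF₃ : ∀ x, 0 ≤ F₃ x) (hF₄ : ∀ x, 0 ≤ F₄ x)
    (h : ∀ᵐ x ∂ν, F₁ x + F₂ x ≤ (F₃ x + F₄ x) / 2) :
    ∫⁻ x, ENNReal.ofReal (F₁ x) ∂ν + ∫⁻ x, ENNReal.ofReal (F₂ x) ∂ν ≤
      2⁻¹ * (∫⁻ x, ENNReal.ofReal (F₃ x) ∂ν + ∫⁻ x, ENNReal.ofReal (F₄ x) ∂ν) := by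
  rw [← lintegral_add_left' h₁.ennreal_ofReal, ← lintegral_add_left' h₃.ennreal_ofReal,
    ← lintegral_const_mul' _ _ (by simp)]
  refine lintegral_mono_ae ?_
  filter_upwards [h] with x hx
  rw [← ENNReal.ofReal_add (hF₁ x) (hF₂ x), ← ENNReal.ofReal_add (hF₃ x) (hF₄ x),
    show (2⁻¹ : ENNReal) = ENNReal.ofReal 2⁻¹ by
      rw [ENNReal.ofReal_inv_of_pos (by norm_num)]; simp,
    ← ENNReal.ofReal_mul (by norm_num)]
  exact ENNReal.ofReal_le_ofReal (by linarith)

lemma lintegral_le_liminf_of_tendsto {α : Type*} [MeasurableSpace α] {ν : Measure α}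
    {F : ℕ → α → ENNReal} {f : α → ENNReal} (hF : ∀ n, AEMeasurable (F n) ν)
    (h : ∀ᵐ x ∂ν, Tendsto (fun n => F n x) atTop (𝓝 (f x))) :
    ∫⁻ x, f x ∂ν ≤ liminf (fun n => ∫⁻ x, F n x ∂ν) atTop := by
  refine le_trans (le_of_eq (lintegral_congr_ae ?_)) (lintegral_liminf_le' hF)
  filter_upwards [h] with x hx
  exact hx.liminf_eq.symm

lemma liminf_add_liminf_le (u v : ℕ → ENNReal) :
    liminf u atTop + liminf v atTop ≤ liminf (fun n => u n + v n) atTop := by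
  rw [liminf_eq_iSup_iInf_of_nat, liminf_eq_iSup_iInf_of_nat, liminf_eq_iSup_iInf_of_nat,
    ENNReal.iSup_add_iSup_of_monotone]
  · exact iSup_mono fun n => le_iInf₂ fun i hi => add_le_add (iInf₂_le i hi) (iInf₂_le i hi)
  · exact fun m n hmn => le_iInf₂ fun i hi => iInf₂_le i (le_trans hmn hi)
  · exact fun m n hmn => le_iInf₂ fun i hi => iInf₂_le i (le_trans hmn hi)

lemma ae_prod_of_ae {G : Set ℂ} {P : ℂ → Prop}
    (h : ∀ᵐ x ∂((volume : Measure ℂ).restrict G), P x) :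
    ∀ᵐ z ∂(((volume : Measure ℂ).restrict G).prod ((volume : Measure ℂ).restrict G)),
      P z.1 ∧ P z.2 :=
  (Measure.quasiMeasurePreserving_fst.ae h).and (Measure.quasiMeasurePreserving_snd.ae h)

lemma gagliardo_congr {s p : ℝ} {G : Set ℂ} {u v : ℂ → ℝ}
    (h : u =ᵐ[(volume : Measure ℂ).restrict G] v) : gagliardo s p G u = gagliardo s p G v := by
  refine lintegral_congr_ae ?_
  filter_upwards [ae_prod_of_ae h] with z hz
  rw [hz.1, hz.2]

lemma trace_congr {G : Set ℂ} {u v : ℂ → ℝ}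
    (h : u =ᵐ[(volume : Measure ℂ).restrict G] v) : trace G u = trace G v := by
  funext x
  have : ∀ r : ℝ, ⨍ y in Metric.ball x r ∩ G, u y = ⨍ y in Metric.ball x r ∩ G, v y := fun r =>
    average_congr (ae_restrict_of_ae_restrict_of_subset Set.inter_subset_right h)
  simp only [trace, this]

lemma measurable_gagliardo_integrand {s p : ℝ} {u : ℂ → ℝ} (hu : Measurable u) :
    Measurable fun z : ℂ × ℂ => |u z.1 - u z.2| ^ p / ‖z.1 - z.2‖ ^ (2 + s * p) := by
  have h1 : Measurable fun z : ℂ × ℂ => |u z.1 - u z.2| :=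
    ((hu.comp measurable_fst).sub (hu.comp measurable_snd)).abs
  have h2 : Measurable fun z : ℂ × ℂ => ‖z.1 - z.2‖ := (measurable_fst.sub measurable_snd).norm
  exact (h1.pow_const p).div (h2.pow_const _)

lemma gagliardo_clarkson {s p : ℝ} (hp : 2 ≤ p) {G : Set ℂ} {u v : ℂ → ℝ} (hu : Measurable u)
    (hv : Measurable v) :
    gagliardo s p G (fun x => (u x + v x) / 2) + gagliardo s p G (fun x => (u x - v x) / 2) ≤
      2⁻¹ * (gagliardo s p G u + gagliardo s p G v) := by
  refine lintegral_ofReal_clarkson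
    (measurable_gagliardo_integrand ((hu.add hv).div_const 2)).aemeasurable
    (measurable_gagliardo_integrand hu).aemeasurable (fun z => by positivity)
    (fun z => by positivity) (fun z => by positivity) (fun z => by positivity)
    (Eventually.of_forall fun z => ?_)
  have h := abs_half_add_rpow_add_abs_half_sub_rpow_le hp (u z.1 - u z.2) (v z.1 - v z.2)
  rw [← add_div, ← add_div, div_right_comm]
  refine div_le_div_of_nonneg_right (le_trans (le_of_eq ?_) h) (by positivity)
  congr 3 <;> ring

lemma gagliardo_le_liminf {s p : ℝ} (hp : 0 < p) {G : Set ℂ} {v : ℕ → ℂ → ℝ} {u : ℂ → ℝ}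
    (hv : ∀ n, Measurable (v n)) (h : ∀ᵐ x ∂((volume : Measure ℂ).restrict G),
      Tendsto (fun n => v n x) atTop (𝓝 (u x))) :
    gagliardo s p G u ≤ liminf (fun n => gagliardo s p G (v n)) atTop := by
  refine lintegral_le_liminf_of_tendsto
    (fun n => (measurable_gagliardo_integrand (hv n)).ennreal_ofReal.aemeasurable) ?_
  filter_upwards [ae_prod_of_ae h] with z hz
  exact ENNReal.tendsto_ofReal
    ((((hz.1.sub hz.2).abs).rpow_const (Or.inr hp.le)).div_const _)

/-- Numerator and volume are both parametric integrals of a jointly measurable integrand, the second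
with the function `1`. -/
lemma measurable_setAverage_ball {G : Set ℂ} {u : ℂ → ℝ} (hu : Measurable u) (r : ℝ) :
    Measurable fun x => ⨍ y in Metric.ball x r ∩ G, u y := by
  have key : ∀ w : ℂ → ℝ, Measurable w →
      Measurable fun x => ∫ y in Metric.ball x r ∩ G, w y := by
    intro w hw
    have hset : MeasurableSet {z : ℂ × ℂ | dist z.2 z.1 < r} :=
      measurableSet_lt (measurable_snd.dist measurable_fst) measurable_const
    have hm : StronglyMeasurable (Function.uncurry fun x y =>
        (Metric.ball x r).indicator w y) :=
      ((hw.comp measurable_snd).indicator hset).stronglyMeasurable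
    have h := (hm.integral_prod_right (ν := (volume : Measure ℂ).restrict G)).measurable
    convert h using 2 with x
    rw [integral_indicator measurableSet_ball, Measure.restrict_restrict measurableSet_ball]
  simp only [setAverage_eq, smul_eq_mul]
  refine Measurable.mul (Measurable.inv ?_) (key u hu)
  have h1 := key (fun _ => 1) measurable_const
  simpa using h1

lemma aemeasurable_trace {G : Set ℂ} {u : ℂ → ℝ} (hu : Measurable u) {ν : Measure ℂ}
    (h : ∀ᵐ x ∂ν, Tendsto (fun r : ℝ => ⨍ y in Metric.ball x r ∩ G, u y) (𝓝[>] 0)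
      (𝓝 (trace G u x))) : AEMeasurable (trace G u) ν :=
  aemeasurable_of_tendsto_metrizable_ae (𝓝[>] (0 : ℝ))
    (fun r => (measurable_setAverage_ball hu r).aemeasurable) h

lemma tendsto_setAverage_add_mul {G : Set ℂ} {u v : ℂ → ℝ} (hu : IntegrableOn u G)
    (hv : IntegrableOn v G) {x : ℂ} {k l : ℝ} (a b : ℝ)
    (hux : Tendsto (fun r : ℝ => ⨍ y in Metric.ball x r ∩ G, u y) (𝓝[>] 0) (𝓝 k))
    (hvx : Tendsto (fun r : ℝ => ⨍ y in Metric.ball x r ∩ G, v y) (𝓝[>] 0) (𝓝 l)) :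
    Tendsto (fun r : ℝ => ⨍ y in Metric.ball x r ∩ G, (a * u y + b * v y)) (𝓝[>] 0)
      (𝓝 (a * k + b * l)) := by
  refine ((hux.const_mul a).add (hvx.const_mul b)).congr fun r => ?_
  simp only [setAverage_eq, smul_eq_mul]
  rw [integral_add ((hu.mono_set Set.inter_subset_right).const_mul a)
    ((hv.mono_set Set.inter_subset_right).const_mul b), integral_const_mul, integral_const_mul]
  ring

lemma abs_setAverage_le {α : Type*} [MeasurableSpace α] {μ : Measure α} {S : Set α} {w : α → ℝ}
    {ε : ℝ} (hε : 0 ≤ ε) (h : ∀ᵐ x ∂μ.restrict S, |w x| ≤ ε) : |⨍ y in S, w y ∂μ| ≤ ε := by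
  rw [setAverage_eq, smul_eq_mul, abs_mul, abs_inv, abs_of_nonneg measureReal_nonneg]
  -- If the measure of `S` is zero or infinite, the average is `0` by convention.
  rcases eq_or_ne (μ.real S) 0 with h0 | h0
  · simpa [h0] using hε
  · have hfin : μ S < ⊤ := lt_top_iff_ne_top.2 fun h' => h0 (by simp [Measure.real, h'])
    rw [inv_mul_le_iff₀ (lt_of_le_of_ne measureReal_nonneg h0.symm), mul_comm]
    exact norm_setIntegral_le_of_norm_le_const_ae (f := w) hfin h

end FracSobolev

namespace Snowflake

open FracSobolev

/-! ### The penalty on the snowflake domain -/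

instance : IsFiniteMeasure ((volume : Measure ℂ).restrict domain) :=
  ⟨by rw [Measure.restrict_apply_univ]; exact isBounded_domain.measure_lt_top⟩

lemma integrableOn_coe {p : ℝ} (hp : 1 ≤ p) (v : LebesgueSpace p domain) :
    IntegrableOn v domain :=
  (Lp.memLp v).integrable (by simpa using hp)

/-- Morrey's inequality on the snowflake domain. -/
lemma exists_morrey {s p : ℝ} (hp : 1 ≤ p) (hsp : 2 < s * p) : ∃ K : ℝ, 0 ≤ K ∧
    ∀ u : ℂ → ℝ, IntegrableOn u domain → gagliardo s p domain u < ⊤ → ∀ x ∈ curve ∪ domain,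
      Tendsto (fun r : ℝ => ⨍ y in Metric.ball x r ∩ domain, u y) (𝓝[>] 0)
        (𝓝 (trace domain u x)) ∧
      |trace domain u x - ⨍ y in domain, u y| ≤
        K * (gagliardo s p domain u).toReal ^ (1 / p) := by
  obtain ⟨R, c, hR, hc, h1, h2⟩ := exists_measure_density
  refine ⟨_, ?_, fun u hu hgu x hx => tendsto_trace_and_abs_trace_sub_average_le hp hsp hc hR
    isOpen_domain.measurableSet hu hgu (h1 x hx) (h2 x hx)⟩
  have hα : 0 < (s * p - 2) / p := div_pos (by linarith) (by linarith)
  have hq : (2⁻¹ : ℝ) ^ ((s * p - 2) / p) < 1 :=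
    Real.rpow_lt_one (by norm_num) (by norm_num) hα
  have hq' : (0 : ℝ) < 1 - 2⁻¹ ^ ((s * p - 2) / p) := by linarith
  positivity

/-- The `p`-homogeneous part of the functional `J_p`, without the factor `1 / p`. -/
def penalty (s p : ℝ) (b : ℂ → ℝ) (u : ℂ → ℝ) : ENNReal :=
  gagliardo s p domain u +
    ∫⁻ x, ENNReal.ofReal (b x * |trace domain u x| ^ p) ∂boundaryMeasure

lemma penalty_congr {s p : ℝ} {b u v : ℂ → ℝ}
    (h : u =ᵐ[(volume : Measure ℂ).restrict domain] v) : penalty s p b u = penalty s p b v := by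
  rw [penalty, penalty, gagliardo_congr h, trace_congr h]

lemma gagliardo_le_penalty {s p : ℝ} {b u : ℂ → ℝ} :
    gagliardo s p domain u ≤ penalty s p b u := le_self_add

lemma aemeasurable_weight {b : ℂ → ℝ} (hb : ContinuousOn b (closure domain)) :
    AEMeasurable b boundaryMeasure := by
  rw [← Measure.restrict_eq_self_of_ae_mem ae_mem_curve]
  exact (hb.mono curve_subset_closure_domain).aemeasurable isCompact_curve.isClosed.measurableSet

lemma ae_weight_nonneg {b : ℂ → ℝ} (hbpos : ∀ x ∈ closure domain, 0 < b x) :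
    ∀ᵐ x ∂boundaryMeasure, 0 ≤ b x := by
  filter_upwards [ae_mem_curve] with x hx
  exact (hbpos x (curve_subset_closure_domain hx)).le

variable {s p : ℝ} {b : ℂ → ℝ}

lemma tendsto_trace (hp : 1 ≤ p) (hsp : 2 < s * p) {u : ℂ → ℝ} (hu : IntegrableOn u domain)
    (hgu : gagliardo s p domain u < ⊤) {x : ℂ} (hx : x ∈ curve) :
    Tendsto (fun r : ℝ => ⨍ y in Metric.ball x r ∩ domain, u y) (𝓝[>] 0)
      (𝓝 (trace domain u x)) := by
  obtain ⟨K, -, h⟩ := exists_morrey hp hsp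
  exact (h u hu hgu x (Or.inl hx)).1

lemma aemeasurable_boundary_integrand (hp : 1 ≤ p) (hsp : 2 < s * p)
    (hb : ContinuousOn b (closure domain)) {u : ℂ → ℝ} (hum : Measurable u)
    (hu : IntegrableOn u domain) (hgu : gagliardo s p domain u < ⊤) :
    AEMeasurable (fun x => b x * |trace domain u x| ^ p) boundaryMeasure := by
  have h : AEMeasurable (trace domain u) boundaryMeasure := by
    refine aemeasurable_trace hum ?_
    filter_upwards [ae_mem_curve] with x hx using tendsto_trace hp hsp hu hgu hx
  exact (aemeasurable_weight hb).mul (h.abs.pow_const p)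

/-- Morrey's inequality bounds the trace uniformly on the curve, `b` is bounded on the compact
closure, and the boundary measure is finite. -/
lemma penalty_lt_top (hp : 1 ≤ p) (hsp : 2 < s * p) (hb : ContinuousOn b (closure domain))
    (hbpos : ∀ x ∈ closure domain, 0 < b x) {u : ℂ → ℝ}
    (hu : IntegrableOn u domain) (hgu : gagliardo s p domain u < ⊤) :
    penalty s p b u < ⊤ := by
  obtain ⟨K, hK, h⟩ := exists_morrey hp hsp
  obtain ⟨B, hB⟩ := isCompact_closure_domain.exists_bound_of_continuousOn hb
  refine ENNReal.add_lt_top.2 ⟨hgu, ?_⟩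
  set M := |⨍ y in domain, u y| + K * (gagliardo s p domain u).toReal ^ (1 / p)
  refine lt_of_le_of_lt (lintegral_mono_ae (g := fun _ => ENNReal.ofReal (B * M ^ p)) ?_) ?_
  · filter_upwards [ae_mem_curve] with x hx
    have hxc := curve_subset_closure_domain hx
    have h1 := (h u hu hgu x (Or.inl hx)).2
    have h2 : |trace domain u x| ≤ M := by
      have := abs_sub_abs_le_abs_sub (trace domain u x) (⨍ y in domain, u y)
      linarith
    have h3 : b x ≤ B := (le_abs_self _).trans (hB x hxc)
    have h4 := hbpos x hxc
    have h5 : 0 ≤ B := h4.le.trans h3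
    refine ENNReal.ofReal_le_ofReal ?_
    gcongr
  · rw [lintegral_const]
    exact ENNReal.mul_lt_top ENNReal.ofReal_lt_top (measure_lt_top _ _)

lemma penalty_clarkson (hp : 2 ≤ p) (hsp : 2 < s * p) (hb : ContinuousOn b (closure domain))
    (hbpos : ∀ x ∈ closure domain, 0 < b x) {u v : ℂ → ℝ} (hum : Measurable u) (hvm : Measurable v)
    (hu : IntegrableOn u domain) (hv : IntegrableOn v domain)
    (hgu : gagliardo s p domain u < ⊤) (hgv : gagliardo s p domain v < ⊤) :
    penalty s p b (fun x => (u x + v x) / 2) + penalty s p b (fun x => (u x - v x) / 2) ≤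
      2⁻¹ * (penalty s p b u + penalty s p b v) := by
  have hp1 : 1 ≤ p := by linarith
  -- Truncating `b` at `0` changes nothing almost everywhere and supplies the pointwise
  -- nonnegativity that `lintegral_ofReal_clarkson` asks for.
  set F : (ℂ → ℝ) → ℂ → ℝ := fun w x => max (b x) 0 * |trace domain w x| ^ p with hF
  have hpen : ∀ w, penalty s p b w = gagliardo s p domain w +
      ∫⁻ x, ENNReal.ofReal (F w x) ∂boundaryMeasure := by
    intro w
    rw [penalty]
    congr 1
    refine lintegral_congr_ae ?_
    filter_upwards [ae_weight_nonneg hbpos] with x hx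
    simp only [hF]
    rw [max_eq_left hx]
  have hF0 : ∀ w x, 0 ≤ F w x := fun w x => mul_nonneg (le_max_right _ _) (by positivity)
  have hFm : ∀ w : ℂ → ℝ, Measurable w → IntegrableOn w domain → gagliardo s p domain w < ⊤ →
      AEMeasurable (F w) boundaryMeasure := by
    intro w h1 h2 h3
    refine (aemeasurable_boundary_integrand hp1 hsp hb h1 h2 h3).congr ?_
    filter_upwards [ae_weight_nonneg hbpos] with x hx
    simp only [hF]
    rw [max_eq_left hx]
  have hgc := gagliardo_clarkson (s := s) (G := domain) hp hum hvm
  have hgadd : gagliardo s p domain (fun x => (u x + v x) / 2) < ⊤ :=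
    (le_self_add.trans hgc).trans_lt (ENNReal.mul_lt_top (by simp)
      (ENNReal.add_lt_top.2 ⟨hgu, hgv⟩))
  have hbd : ∫⁻ x, ENNReal.ofReal (F (fun x => (u x + v x) / 2) x) ∂boundaryMeasure +
      ∫⁻ x, ENNReal.ofReal (F (fun x => (u x - v x) / 2) x) ∂boundaryMeasure ≤
      2⁻¹ * (∫⁻ x, ENNReal.ofReal (F u x) ∂boundaryMeasure +
        ∫⁻ x, ENNReal.ofReal (F v x) ∂boundaryMeasure) := by
    refine lintegral_ofReal_clarkson
      (hFm _ ((hum.add hvm).div_const 2) ((hu.add hv).div_const 2) hgadd)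
      (hFm _ hum hu hgu) (hF0 _) (hF0 _) (hF0 _) (hF0 _) ?_
    filter_upwards [ae_mem_curve] with x hx
    have hux := tendsto_trace hp1 hsp hu hgu hx
    have hvx := tendsto_trace hp1 hsp hv hgv hx
    have e1 : trace domain (fun x => (u x + v x) / 2) x =
        (trace domain u x + trace domain v x) / 2 := by
      have := (tendsto_setAverage_add_mul hu hv (1 / 2) (1 / 2) hux hvx).limUnder_eq
      rw [trace]
      convert this using 4 with r <;> ring_nf
    have e2 : trace domain (fun x => (u x - v x) / 2) x =
        (trace domain u x - trace domain v x) / 2 := by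
      have := (tendsto_setAverage_add_mul hu hv (1 / 2) (-1 / 2) hux hvx).limUnder_eq
      rw [trace]
      convert this using 4 with r <;> ring_nf
    simp only [hF]
    rw [e1, e2, ← mul_add, ← mul_add, mul_div_assoc]
    exact mul_le_mul_of_nonneg_left (abs_half_add_rpow_add_abs_half_sub_rpow_le hp _ _)
      (le_max_right _ _)
  simp only [hpen]
  calc _ = (gagliardo s p domain (fun x => (u x + v x) / 2) +
        gagliardo s p domain (fun x => (u x - v x) / 2)) +
        (∫⁻ x, ENNReal.ofReal (F (fun x => (u x + v x) / 2) x) ∂boundaryMeasure +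
      ∫⁻ x, ENNReal.ofReal (F (fun x => (u x - v x) / 2) x) ∂boundaryMeasure) := by abel
    _ ≤ _ := add_le_add hgc hbd
    _ = _ := by rw [← mul_add]; congr 1; abel

/-- The supremum of a function is controlled by the penalty. -/
lemma exists_ae_abs_le_penalty (hp : 1 ≤ p) (hsp : 2 < s * p)
    (hb : ContinuousOn b (closure domain)) (hbpos : ∀ x ∈ closure domain, 0 < b x) :
    ∃ C : ℝ, 0 ≤ C ∧ ∀ u : ℂ → ℝ, IntegrableOn u domain → gagliardo s p domain u < ⊤ →
      ∀ᵐ x ∂((volume : Measure ℂ).restrict domain),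
        |u x| ≤ C * (penalty s p b u).toReal ^ (1 / p) := by
  have hp0 : 0 < p := by linarith
  obtain ⟨K, hK, h⟩ := exists_morrey hp hsp
  obtain ⟨b₀, hb₀, hbb⟩ : ∃ b₀ : ℝ, 0 < b₀ ∧ ∀ x ∈ closure domain, b₀ ≤ b x := by
    rcases (closure domain).eq_empty_or_nonempty with he | hne
    · exact ⟨1, one_pos, by simp [he]⟩
    · obtain ⟨x₀, hx₀, hmin⟩ := isCompact_closure_domain.exists_isMinOn hne hb
      exact ⟨b x₀, hbpos x₀ hx₀, fun x hx => hmin hx⟩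
  refine ⟨2 * K + (1 / b₀) ^ (1 / p), by positivity, fun u hu hgu => ?_⟩
  have hpen := penalty_lt_top hp hsp hb hbpos hu hgu
  set q := (penalty s p b u).toReal with hq
  set N := (gagliardo s p domain u).toReal with hN
  set β := ⨍ y in domain, u y with hβ
  have hNq : K * N ^ (1 / p) ≤ K * q ^ (1 / p) := by
    gcongr
    exact ENNReal.toReal_mono hpen.ne gagliardo_le_penalty
  have hβle : |β| - K * N ^ (1 / p) ≤ (1 / b₀) ^ (1 / p) * q ^ (1 / p) := by
    rcases le_or_gt (|β| - K * N ^ (1 / p)) 0 with h0 | h0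
    · exact h0.trans (by positivity)
    -- If the mean exceeds the Morrey oscillation by `c₀ > 0`, then `|trace| ≥ c₀` on the whole
    -- curve, and the boundary term alone is at least `3 * b₀ * c₀ ^ p`.
    · set c₀ := |β| - K * N ^ (1 / p) with hc₀
      have h1 : ENNReal.ofReal (b₀ * c₀ ^ p) ≤ penalty s p b u := by
        calc ENNReal.ofReal (b₀ * c₀ ^ p) ≤ ENNReal.ofReal (b₀ * c₀ ^ p) * 3 :=
              le_mul_of_one_le_right zero_le (by norm_num)
          _ = ∫⁻ _, ENNReal.ofReal (b₀ * c₀ ^ p) ∂boundaryMeasure := by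
              rw [lintegral_const, boundaryMeasure_univ]
          _ ≤ ∫⁻ x, ENNReal.ofReal (b x * |trace domain u x| ^ p) ∂boundaryMeasure := by
              refine lintegral_mono_ae ?_
              filter_upwards [ae_mem_curve] with x hx
              have h2 := (h u hu hgu x (Or.inl hx)).2
              have h3 := abs_sub_abs_le_abs_sub β (trace domain u x)
              rw [abs_sub_comm] at h3
              have h4 := hbb x (curve_subset_closure_domain hx)
              have h5 : c₀ ≤ |trace domain u x| := by linarith
              have h6 : 0 ≤ b x := hb₀.le.trans h4
              refine ENNReal.ofReal_le_ofReal ?_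
              gcongr
          _ ≤ penalty s p b u := le_add_self
      rw [← ENNReal.ofReal_toReal hpen.ne, ← hq,
        ENNReal.ofReal_le_ofReal_iff ENNReal.toReal_nonneg] at h1
      have hq0 : 0 ≤ q := ENNReal.toReal_nonneg
      rw [← Real.mul_rpow (by positivity) hq0, one_div_mul_eq_div,
        one_div p, Real.le_rpow_inv_iff_of_pos h0.le (by positivity) hp0, le_div_iff₀ hb₀, mul_comm]
      exact h1
  filter_upwards [ae_trace_eq hu, ae_restrict_mem isOpen_domain.measurableSet] with x hx hxd
  have h2 := (h u hu hgu x (Or.inr hxd)).2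
  rw [hx] at h2
  have h3 := abs_sub_abs_le_abs_sub (u x) β
  linarith

/-- Uniform convergence in the domain implies convergence of the traces. -/
lemma abs_trace_sub_trace_le (hp : 1 ≤ p) (hsp : 2 < s * p) {u v : ℂ → ℝ}
    (hu : IntegrableOn u domain) (hv : IntegrableOn v domain)
    (hgu : gagliardo s p domain u < ⊤) (hgv : gagliardo s p domain v < ⊤) {ε : ℝ} (hε : 0 ≤ ε)
    (h : ∀ᵐ x ∂((volume : Measure ℂ).restrict domain), |u x - v x| ≤ ε) {x : ℂ} (hx : x ∈ curve) :
    |trace domain u x - trace domain v x| ≤ ε := by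
  have hlim := (tendsto_setAverage_add_mul hu hv 1 (-1) (tendsto_trace hp hsp hu hgu hx)
    (tendsto_trace hp hsp hv hgv hx)).abs
  rw [show 1 * trace domain u x + -1 * trace domain v x =
    trace domain u x - trace domain v x by ring] at hlim
  refine le_of_tendsto hlim (Eventually.of_forall fun r => abs_setAverage_le hε ?_)
  filter_upwards [ae_restrict_of_ae_restrict_of_subset Set.inter_subset_right h] with y hy
  rwa [show 1 * u y + -1 * v y = u y - v y by ring]

/-- Fatou's lemma handles both terms. Almost everywhere convergence in the domain suffices for the
seminorm but says nothing on the curve; the uniform bound makes the traces converge there. -/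
lemma penalty_le_liminf (hp : 1 ≤ p) (hsp : 2 < s * p) (hb : ContinuousOn b (closure domain))
    {v : ℕ → ℂ → ℝ} {u : ℂ → ℝ}
    (hvm : ∀ n, Measurable (v n)) (hv : ∀ n, IntegrableOn (v n) domain)
    (hgv : ∀ n, gagliardo s p domain (v n) < ⊤) (hu : IntegrableOn u domain)
    (hgu : gagliardo s p domain u < ⊤) {ε : ℕ → ℝ} (hε : Tendsto ε atTop (𝓝 0))
    (hε0 : ∀ n, 0 ≤ ε n)
    (h : ∀ n, ∀ᵐ x ∂((volume : Measure ℂ).restrict domain), |v n x - u x| ≤ ε n) :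
    penalty s p b u ≤ liminf (fun n => penalty s p b (v n)) atTop := by
  have hp0 : 0 < p := by linarith
  refine le_trans (add_le_add ?_ ?_) (liminf_add_liminf_le _ _)
  · refine gagliardo_le_liminf hp0 hvm ?_
    filter_upwards [ae_all_iff.2 h] with x hx
    exact tendsto_iff_norm_sub_tendsto_zero.2 (squeeze_zero (fun n => norm_nonneg _) hx hε)
  · refine lintegral_le_liminf_of_tendsto (fun n => (aemeasurable_boundary_integrand hp hsp hb
      (hvm n) (hv n) (hgv n)).ennreal_ofReal) ?_
    filter_upwards [ae_mem_curve] with x hx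
    have htr : Tendsto (fun n => trace domain (v n) x) atTop (𝓝 (trace domain u x)) :=
      tendsto_iff_norm_sub_tendsto_zero.2 (squeeze_zero (fun n => norm_nonneg _)
        (fun n => abs_trace_sub_trace_le hp hsp (hv n) hu (hgv n) hgu (hε0 n) (h n) hx) hε)
    exact ENNReal.tendsto_ofReal ((htr.abs.rpow_const (Or.inr hp0.le)).const_mul _)

/-! ### The obstacle problem: convexity, existence and uniqueness -/

variable {f : ℂ → ℝ} {φ₁ φ₂ : LebesgueSpace p domain}

lemma energy_eq (hp : 1 ≤ p) (hsp : 2 < s * p) (hb : ContinuousOn b (closure domain))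
    (hbpos : ∀ x ∈ closure domain, 0 < b x) {v : LebesgueSpace p domain}
    (hv : v ∈ space s p domain) :
    energy s p f b v = 1 / p * (penalty s p b v).toReal - ∫ x in domain, f x * v x := by
  have hvi := integrableOn_coe hp v
  have hfin := ENNReal.add_lt_top.1 (penalty_lt_top hp hsp hb hbpos hvi hv)
  rw [energy, penalty, ENNReal.toReal_add hfin.1.ne hfin.2.ne,
    integral_eq_lintegral_of_nonneg_ae (μ := boundaryMeasure)]
  · ring
  · filter_upwards [ae_weight_nonneg hbpos] with x hx
    exact mul_nonneg hx (by positivity)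
  · exact (aemeasurable_boundary_integrand hp hsp hb (Lp.stronglyMeasurable v).measurable hvi
      hv).aestronglyMeasurable

/-- Functions between the two obstacles are uniformly bounded. -/
lemma exists_bound_of_mem_admissible (hp : 1 ≤ p) (hsp : 2 < s * p)
    (hφ₁ : φ₁ ∈ space s p domain) (hφ₂ : φ₂ ∈ space s p domain) :
    ∃ M : ℝ, 0 ≤ M ∧ ∀ v ∈ admissible s p φ₁ φ₂,
      ∀ᵐ x ∂((volume : Measure ℂ).restrict domain), |v x| ≤ M := by
  -- The weight plays no role in a supremum bound for the obstacles, so `1` is taken.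
  obtain ⟨C, hC, h⟩ := exists_ae_abs_le_penalty (b := fun _ => 1) hp hsp continuousOn_const
    fun _ _ => one_pos
  set M₁ := C * (penalty s p (fun _ => 1) φ₁).toReal ^ (1 / p)
  set M₂ := C * (penalty s p (fun _ => 1) φ₂).toReal ^ (1 / p)
  refine ⟨max M₁ M₂, le_max_of_le_left (by positivity), fun v hv => ?_⟩
  filter_upwards [hv.2, h φ₁ (integrableOn_coe hp φ₁) hφ₁, h φ₂ (integrableOn_coe hp φ₂) hφ₂]
    with x hx h1 h2
  rw [abs_le] at h1 h2 ⊢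
  have h3 := le_max_left M₁ M₂
  have h4 := le_max_right M₁ M₂
  constructor <;> linarith

lemma integrableOn_mul (hf : IntegrableOn f domain volume) {v : LebesgueSpace p domain} {M : ℝ}
    (hv : ∀ᵐ x ∂((volume : Measure ℂ).restrict domain), |v x| ≤ M) :
    IntegrableOn (fun x => f x * v x) domain :=
  hf.mul_bdd (c := M) (Lp.stronglyMeasurable v).aestronglyMeasurable hv

lemma coe_half_add (v w : LebesgueSpace p domain) :
    ((2⁻¹ : ℝ) • (v + w) : LebesgueSpace p domain) =ᵐ[(volume : Measure ℂ).restrict domain]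
      fun x => (v x + w x) / 2 := by
  filter_upwards [Lp.coeFn_smul (2⁻¹ : ℝ) (v + w), Lp.coeFn_add v w] with x h1 h2
  rw [h1, Pi.smul_apply, h2, Pi.add_apply, smul_eq_mul]
  ring

/-- The uniform convexity of the functional. -/
lemma half_add_mem_admissible_and_energy_le (hp : 2 ≤ p) (hsp : 2 < s * p)
    (hf : IntegrableOn f domain volume)
    (hb : ContinuousOn b (closure domain)) (hbpos : ∀ x ∈ closure domain, 0 < b x)
    (hφ₁ : φ₁ ∈ space s p domain) (hφ₂ : φ₂ ∈ space s p domain) {v w : LebesgueSpace p domain}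
    (hv : v ∈ admissible s p φ₁ φ₂) (hw : w ∈ admissible s p φ₁ φ₂) :
    (2⁻¹ : ℝ) • (v + w) ∈ admissible s p φ₁ φ₂ ∧
      gagliardo s p domain (fun x => (v x - w x) / 2) < ⊤ ∧
      energy s p f b ((2⁻¹ : ℝ) • (v + w)) +
        1 / p * (penalty s p b (fun x => (v x - w x) / 2)).toReal ≤
        (energy s p f b v + energy s p f b w) / 2 := by
  have hp1 : 1 ≤ p := by linarith
  have hp0 : 0 < p := by linarith
  have hvi := integrableOn_coe hp1 v
  have hwi := integrableOn_coe hp1 w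
  have hvm := (Lp.stronglyMeasurable v).measurable
  have hwm := (Lp.stronglyMeasurable w).measurable
  have hgc := gagliardo_clarkson (s := s) (G := domain) hp hvm hwm
  have hgfin : 2⁻¹ * (gagliardo s p domain v + gagliardo s p domain w) < ⊤ :=
    ENNReal.mul_lt_top (by simp) (ENNReal.add_lt_top.2 ⟨hv.1, hw.1⟩)
  have hg1 : gagliardo s p domain (fun x => (v x + w x) / 2) < ⊤ :=
    (le_self_add.trans hgc).trans_lt hgfin
  have hg2 : gagliardo s p domain (fun x => (v x - w x) / 2) < ⊤ :=
    (le_add_self.trans hgc).trans_lt hgfin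
  have hmid := coe_half_add v w
  have hmem : (2⁻¹ : ℝ) • (v + w) ∈ admissible s p φ₁ φ₂ := by
    refine ⟨?_, ?_⟩
    · change gagliardo s p domain _ < ⊤
      rwa [gagliardo_congr hmid]
    · filter_upwards [hmid, hv.2, hw.2] with x h1 h2 h3
      rw [h1]
      constructor <;> linarith
  refine ⟨hmem, hg2, ?_⟩
  obtain ⟨M, -, hM⟩ := exists_bound_of_mem_admissible hp1 hsp hφ₁ hφ₂
  rw [energy_eq hp1 hsp hb hbpos hmem.1, energy_eq hp1 hsp hb hbpos hv.1,
    energy_eq hp1 hsp hb hbpos hw.1, penalty_congr hmid]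
  have hlin : ∫ x in domain, f x * ((2⁻¹ : ℝ) • (v + w) : LebesgueSpace p domain) x =
      ((∫ x in domain, f x * v x) + ∫ x in domain, f x * w x) / 2 := by
    rw [← integral_add (integrableOn_mul hf (hM v hv)) (integrableOn_mul hf (hM w hw)),
      ← integral_div]
    refine integral_congr_ae ?_
    filter_upwards [hmid] with x hx
    rw [hx]
    ring
  rw [hlin]
  have hQv := penalty_lt_top hp1 hsp hb hbpos hvi hv.1
  have hQw := penalty_lt_top hp1 hsp hb hbpos hwi hw.1
  have hQ1 : penalty s p b (fun x => (v x + w x) / 2) < ⊤ := penalty_lt_top hp1 hsp hb hbpos ((hvi.add hwi).div_const 2) hg1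
  have hQ2 : penalty s p b (fun x => (v x - w x) / 2) < ⊤ := penalty_lt_top hp1 hsp hb hbpos ((hvi.sub hwi).div_const 2) hg2
  have hcl := ENNReal.toReal_mono (ENNReal.mul_lt_top (by simp)
    (ENNReal.add_lt_top.2 ⟨hQv, hQw⟩)).ne
    (penalty_clarkson hp hsp hb hbpos hvm hwm hvi hwi hv.1 hw.1)
  rw [ENNReal.toReal_mul, ENNReal.toReal_add hQv.ne hQw.ne, ENNReal.toReal_add hQ1.ne hQ2.ne,
    ENNReal.toReal_inv, ENNReal.toReal_ofNat] at hcl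
  have := mul_le_mul_of_nonneg_left hcl (show 0 ≤ 1 / p by positivity)
  linarith

/-- Two admissible functions of almost minimal energy are uniformly close. -/
lemma exists_ae_abs_sub_le (hp : 2 ≤ p) (hsp : 2 < s * p) (hf : IntegrableOn f domain volume)
    (hb : ContinuousOn b (closure domain)) (hbpos : ∀ x ∈ closure domain, 0 < b x)
    (hφ₁ : φ₁ ∈ space s p domain) (hφ₂ : φ₂ ∈ space s p domain) :
    ∃ C : ℝ, 0 ≤ C ∧ ∀ m δ : ℝ, (∀ v ∈ admissible s p φ₁ φ₂, m ≤ energy s p f b v) →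
      ∀ v ∈ admissible s p φ₁ φ₂, ∀ w ∈ admissible s p φ₁ φ₂, energy s p f b v ≤ m + δ →
        energy s p f b w ≤ m + δ →
        ∀ᵐ x ∂((volume : Measure ℂ).restrict domain), |v x - w x| ≤ C * (p * δ) ^ (1 / p) := by
  have hp1 : 1 ≤ p := by linarith
  have hp0 : 0 < p := by linarith
  obtain ⟨C, hC, h⟩ := exists_ae_abs_le_penalty hp1 hsp hb hbpos
  refine ⟨2 * C, by positivity, fun m δ hm v hv w hw hvδ hwδ => ?_⟩
  obtain ⟨h1, h2, h3⟩ := half_add_mem_admissible_and_energy_le hp hsp hf hb hbpos hφ₁ hφ₂ hv hw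
  -- The midpoint has energy at least `m`, so uniform convexity leaves at most `δ` for the penalty
  -- of the half difference; the half explains the factor `2 * C`.
  have h4 := hm _ h1
  have h5 : (penalty s p b fun x => (v x - w x) / 2).toReal ≤ p * δ := by
    have h6 : 1 / p * (penalty s p b fun x => (v x - w x) / 2).toReal ≤ δ := by linarith
    rwa [one_div, inv_mul_le_iff₀ hp0] at h6
  filter_upwards [h (fun x => (v x - w x) / 2)
    (((integrableOn_coe hp1 v).sub (integrableOn_coe hp1 w)).div_const 2) h2] with x hx
  have h6 : C * (penalty s p b fun x => (v x - w x) / 2).toReal ^ (1 / p) ≤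
      C * (p * δ) ^ (1 / p) := by gcongr
  rw [abs_div, abs_two] at hx
  linarith

/-- The penalty is nonnegative, and the linear term is controlled by the integral of `|f|` times the
uniform bound from the obstacles. -/
lemma exists_le_energy (hp : 1 ≤ p) (hsp : 2 < s * p) (hf : IntegrableOn f domain volume)
    (hb : ContinuousOn b (closure domain)) (hbpos : ∀ x ∈ closure domain, 0 < b x)
    (hφ₁ : φ₁ ∈ space s p domain) (hφ₂ : φ₂ ∈ space s p domain) :
    ∃ L : ℝ, ∀ v ∈ admissible s p φ₁ φ₂, L ≤ energy s p f b v := by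
  obtain ⟨M, hM0, hM⟩ := exists_bound_of_mem_admissible hp hsp hφ₁ hφ₂
  refine ⟨-∫ x in domain, ‖f x‖ * M, fun v hv => ?_⟩
  rw [energy_eq hp hsp hb hbpos hv.1]
  have h1 : ‖∫ x in domain, f x * v x‖ ≤ ∫ x in domain, ‖f x‖ * M := by
    refine norm_integral_le_of_norm_le (hf.norm.mul_const M) ?_
    filter_upwards [hM v hv] with x hx
    rw [norm_mul]
    gcongr
    exact hx
  have h2 : 0 ≤ 1 / p * (penalty s p b v).toReal := by positivity
  have h3 := (le_abs_self _).trans h1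
  linarith

/-- The functional attains its minimum on the set of admissible functions. -/
lemma exists_isMinOn_energy (hp : 2 ≤ p) (hsp : 2 < s * p) (hf : IntegrableOn f domain volume)
    (hb : ContinuousOn b (closure domain)) (hbpos : ∀ x ∈ closure domain, 0 < b x)
    (hφ₁ : φ₁ ∈ space s p domain) (hφ₂ : φ₂ ∈ space s p domain)
    (hK : (admissible s p φ₁ φ₂).Nonempty) :
    ∃ u ∈ admissible s p φ₁ φ₂, IsMinOn (energy s p f b) (admissible s p φ₁ φ₂) u := by
  have hp1 : 1 ≤ p := by linarith
  have hp0 : 0 < p := by linarith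
  obtain ⟨L, hL⟩ := exists_le_energy hp1 hsp hf hb hbpos hφ₁ hφ₂
  obtain ⟨M, hM0, hM⟩ := exists_bound_of_mem_admissible hp1 hsp hφ₁ hφ₂
  set m := sInf (energy s p f b '' admissible s p φ₁ φ₂) with hm_def
  have hm : ∀ v ∈ admissible s p φ₁ φ₂, m ≤ energy s p f b v := fun v hv =>
    csInf_le ⟨L, by rintro _ ⟨w, hw, rfl⟩; exact hL w hw⟩ ⟨v, hv, rfl⟩
  have hseq : ∀ n : ℕ, ∃ v ∈ admissible s p φ₁ φ₂, energy s p f b v < m + 1 / ((n : ℝ) + 1) := by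
    intro n
    obtain ⟨_, ⟨v, hv, rfl⟩, h⟩ := exists_lt_of_csInf_lt (hK.image (energy s p f b))
      (lt_add_of_pos_right m (Nat.one_div_pos_of_nat (n := n)))
    exact ⟨v, hv, h⟩
  choose v hv hvm using hseq
  obtain ⟨C, hC, hclose⟩ := exists_ae_abs_sub_le hp hsp hf hb hbpos hφ₁ hφ₂
  set ε : ℕ → ℝ := fun n => C * (p * (1 / ((n : ℝ) + 1))) ^ (1 / p) with hε_def
  have hε0 : ∀ n, 0 ≤ ε n := fun n => by positivity
  have hε : Tendsto ε atTop (𝓝 0) := by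
    have h1 := ((tendsto_one_div_add_atTop_nhds_zero_nat (𝕜 := ℝ)).const_mul p).rpow_const
      (p := 1 / p) (Or.inr (by positivity))
    have h2 := h1.const_mul C
    rwa [mul_zero, Real.zero_rpow (by positivity), mul_zero] at h2
  have hcau : ∀ N n k : ℕ, N ≤ n → N ≤ k →
      ∀ᵐ x ∂((volume : Measure ℂ).restrict domain), |v n x - v k x| ≤ ε N := by
    intro N n k hn hk
    exact hclose m _ hm (v n) (hv n) (v k) (hv k)
      ((hvm n).le.trans (by gcongr)) ((hvm k).le.trans (by gcongr))
  -- Countably many null sets are discarded together, so almost every point carries a Cauchy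
  -- sequence.
  have hcau' : ∀ᵐ x ∂((volume : Measure ℂ).restrict domain), ∀ N n k : ℕ, N ≤ n → N ≤ k →
      |v n x - v k x| ≤ ε N := by
    simp only [ae_all_iff]
    exact hcau
  obtain ⟨g, hgm, hg⟩ := exists_stronglyMeasurable_limit_of_tendsto_ae
    (fun n => (Lp.stronglyMeasurable (v n)).aestronglyMeasurable) (by
      filter_upwards [hcau'] with x hx
      exact cauchySeq_tendsto_of_complete (cauchySeq_of_le_tendsto_0 ε
        (fun n k N hn hk => hx N n k hn hk) hε))
  have hvM : ∀ᵐ x ∂((volume : Measure ℂ).restrict domain), ∀ n, |v n x| ≤ M :=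
    ae_all_iff.2 fun n => hM (v n) (hv n)
  have hgM : ∀ᵐ x ∂((volume : Measure ℂ).restrict domain), ‖g x‖ ≤ M := by
    filter_upwards [hg, hvM] with x hx hxM
    exact le_of_tendsto hx.norm (Eventually.of_forall hxM)
  have hgLp : MemLp g (ENNReal.ofReal p) ((volume : Measure ℂ).restrict domain) :=
    MemLp.of_bound hgm.aestronglyMeasurable M hgM
  set u : LebesgueSpace p domain := hgLp.toLp g with hu_def
  have hlim : ∀ᵐ x ∂((volume : Measure ℂ).restrict domain),
      Tendsto (fun n => v n x) atTop (𝓝 (u x)) := by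
    filter_upwards [hg, hgLp.coeFn_toLp] with x hx hx'
    rwa [hu_def, hx']
  have hunif : ∀ n, ∀ᵐ x ∂((volume : Measure ℂ).restrict domain), |v n x - u x| ≤ ε n := by
    intro n
    filter_upwards [hlim, hcau'] with x hx hxc
    exact le_of_tendsto ((hx.const_sub (v n x)).abs)
      ((eventually_ge_atTop n).mono fun k hk => hxc n n k le_rfl hk)
  have hint : Tendsto (fun n => ∫ x in domain, f x * v n x) atTop
      (𝓝 (∫ x in domain, f x * u x)) := by
    refine tendsto_integral_of_dominated_convergence (fun x => ‖f x‖ * M)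
      (fun n => (integrableOn_mul hf (hM (v n) (hv n))).aestronglyMeasurable)
      (hf.norm.mul_const M) (fun n => ?_) ?_
    · filter_upwards [hM (v n) (hv n)] with x hx
      rw [norm_mul]
      gcongr
      exact hx
    · filter_upwards [hlim] with x hx using hx.const_mul _
  have hJ : Tendsto (fun n => energy s p f b (v n)) atTop (𝓝 m) := by
    have h1 := (tendsto_one_div_add_atTop_nhds_zero_nat (𝕜 := ℝ)).const_add m
    rw [add_zero] at h1
    exact tendsto_of_tendsto_of_tendsto_of_le_of_le tendsto_const_nhds h1 (fun n => hm _ (hv n))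
      fun n => (hvm n).le
  have hpen_eq : ∀ n, p * (energy s p f b (v n) + ∫ x in domain, f x * v n x) =
      (penalty s p b (v n)).toReal := fun n => by
    rw [energy_eq hp1 hsp hb hbpos (hv n).1]
    field_simp
    ring
  -- Energies and linear terms both converge, hence so do the penalties, to a finite limit.
  have hpen_real := (hJ.add hint).const_mul p
  have hpen : Tendsto (fun n => penalty s p b (v n)) atTop
      (𝓝 (ENNReal.ofReal (p * (m + ∫ x in domain, f x * u x)))) := by
    refine (ENNReal.tendsto_ofReal hpen_real).congr fun n => ?_
    rw [hpen_eq, ENNReal.ofReal_toReal]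
    exact (penalty_lt_top hp1 hsp hb hbpos (integrableOn_coe hp1 (v n)) (hv n).1).ne
  have hmeas : ∀ n, Measurable (v n) := fun n => (Lp.stronglyMeasurable (v n)).measurable
  -- Finiteness of the limit's seminorm comes first, from Fatou's lemma alone, because
  -- `penalty_le_liminf` requires it for the traces.
  have hgu : gagliardo s p domain u < ⊤ := by
    refine ((gagliardo_le_liminf hp0 hmeas hlim).trans
      (liminf_le_liminf (Eventually.of_forall fun n => gagliardo_le_penalty (b := b)))).trans_lt ?_
    rw [hpen.liminf_eq]
    exact ENNReal.ofReal_lt_top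
  have huK : u ∈ admissible s p φ₁ φ₂ := by
    refine ⟨hgu, ?_⟩
    filter_upwards [hlim, ae_all_iff.2 fun n => (hv n).2] with x hx hxn
    exact ⟨ge_of_tendsto' hx fun n => (hxn n).1, le_of_tendsto' hx fun n => (hxn n).2⟩
  refine ⟨u, huK, fun w hw => (?_ : energy s p f b u ≤ m).trans (hm w hw)⟩
  have hle := penalty_le_liminf hp1 hsp hb hmeas (fun n => integrableOn_coe hp1 (v n))
    (fun n => (hv n).1) (integrableOn_coe hp1 u) hgu hε hε0 hunif
  rw [hpen.liminf_eq] at hle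
  have hnn : 0 ≤ p * (m + ∫ x in domain, f x * u x) :=
    ge_of_tendsto' hpen_real fun n => by rw [hpen_eq]; exact ENNReal.toReal_nonneg
  have hle' := ENNReal.toReal_le_of_le_ofReal hnn hle
  rw [energy_eq hp1 hsp hb hbpos hgu, one_div]
  have := (inv_mul_le_iff₀ hp0).2 hle'
  linarith

end Snowflake

end

theorem mainTheorem2 (s p : ℝ) (hsp : 2 < s * p) (hp : s * p < p)
    (f b : ℂ → ℝ)
    (hf : IntegrableOn f Snowflake.domain volume)
    (hb : ContinuousOn b (closure Snowflake.domain))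
    (hbpos : ∀ x ∈ closure Snowflake.domain, 0 < b x)
    (φ₁ φ₂ : FracSobolev.LebesgueSpace p Snowflake.domain)
    (hφ₁ : φ₁ ∈ FracSobolev.space s p Snowflake.domain)
    (hφ₂ : φ₂ ∈ FracSobolev.space s p Snowflake.domain)
    (hφ : ∀ᵐ x ∂((volume : Measure ℂ).restrict Snowflake.domain), φ₁ x ≤ φ₂ x)
    (hK : (Snowflake.admissible s p φ₁ φ₂).Nonempty) :
    ∃! u : FracSobolev.LebesgueSpace p Snowflake.domain,
      u ∈ Snowflake.admissible s p φ₁ φ₂ ∧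
        IsMinOn (Snowflake.energy s p f b) (Snowflake.admissible s p φ₁ φ₂) u := by
  have hp0 : 0 < p := by linarith
  have hp2 : 2 ≤ p := by linarith
  obtain ⟨u, hu, hmin⟩ :=
    Snowflake.exists_isMinOn_energy hp2 hsp hf hb hbpos hφ₁ hφ₂ hK
  refine ⟨u, ⟨hu, hmin⟩, fun v ⟨hv, hvmin⟩ => Lp.ext ?_⟩
  -- Uniqueness is the closeness estimate at `δ = 0`, whose right-hand side vanishes.
  obtain ⟨C, -, hC⟩ := Snowflake.exists_ae_abs_sub_le hp2 hsp hf hb hbpos hφ₁ hφ₂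
  have hvu : Snowflake.energy s p f b v ≤ Snowflake.energy s p f b u + 0 := by
    simpa using hvmin hu
  filter_upwards [hC _ 0 (fun w hw => hmin hw) v hv u hu hvu (by simp)] with x hx
  rw [mul_zero, Real.zero_rpow (by positivity), mul_zero] at hx
  exact sub_eq_zero.1 (abs_nonpos_iff.1 hx)
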